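/- Let $(K,W,\chi)$ be a chiral boson edge theory with $\mathbb{Z}_2$ symmetry: $K$ is a symmetric integer $N\times N$ matrix with $\det K\neq 0$, $W$ is an integer $N\times N$ matrix with $W^2=1$ and $W^TKW=K$, and $\chi\in\mathbb{R}^N$. The theory is called bosonic if all diagonal entries of $K$ are even, and fermionic otherwise. Let $\Xi_\pm=\{\Lambda\in\mathbb{Z}^N : W\Lambda=\pm\Lambda\}$, let $n_\pm$ be the rank of the lattice $\Xi_\pm$, let $V_\pm$ be any integer $N\times n_\pm$ matrix whose columns form a $\mathbb{Z}$-basis of $\Xi_\pm$, and put $K_\pm=V_\pm^TKV_\pm$. For a symmetric matrix $A$ let $\mathrm{sig}(A)$ be the number of positive minus the number of negative eigenvalues of $A$, counted with multiplicity (zero eigenvalues are ignored). Two vectors $l,l'\in\mathbb{Z}^N$ are called equivalent if $l-l'\in K\mathbb{Z}^N$. A Lagrangian subgroup is a set $\mathcal{L}\subset\mathbb{Z}^N$ such that (a) $l^TK^{-1}l'\in\mathbb{Z}$ for all $l,l'\in\mathcal{L}$; (b) in the bosonic case, $l^TK^{-1}l$ is even for all $l\in\mathcal{L}$; (c) if $l'\in\mathbb{Z}^N$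 is not equivalent to any element of $\mathcal{L}$, then $l^TK^{-1}l'\notin\mathbb{Z}$ for some $l\in\mathcal{L}$. It is called invariant if for each $l\in\mathcal{L}$ the vector $W^Tl$ is equivalent to some element of $\mathcal{L}$. Assume that $\mathrm{sig}(K(1-W))=0$, and that (i) $\mathrm{sig}(K)=0$; (ii) there exists an invariant Lagrangian subgroup $\mathcal{L}$; (iii) if the theory is fermionic, then $|\det(K_+)|\cdot 2^{|\mathrm{sig}(K_+)|}$ and $|\det(K_-)|\cdot 2^{|\mathrm{sig}(K_-)|}$ are perfect squares (nothing is required here in the bosonic case). Then $K_+$ and $K_-$ each have a complete set of null vectors: $n_\pm$ is even, and there are $n_\pm/2$ linearly independent vectors $\Lambda_1,\dots,\Lambda_{n_\pm/2}\in\mathbb{Z}^{n_\pm}$ with $\Lambda_i^TK_\pm\Lambda_j=0$ for all $i,j$. -/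

import Mathlib

open Matrix

namespace ChiralEdge

/-- A chiral boson edge theory with `ℤ₂` symmetry: a triplet `(K, W, χ)` with `K` a symmetric,
non-degenerate integer matrix, `W` an integer matrix with `W ^ 2 = 1` and `Wᵀ K W = K`,
and `χ` a real vector. -/
structure EdgeTheory (N : ℕ) where
  K : Matrix (Fin N) (Fin N) ℤ
  W : Matrix (Fin N) (Fin N) ℤ
  χ : Fin N → ℝ
  K_symm : Kᵀ = K
  K_nondegenerate : K.det ≠ 0
  W_sq : W * W = 1
  W_preserves : Wᵀ * K * W = K

/-- The signature of (the real quadratic form `x ↦ xᵀ A x` of) a symmetric integer matrix `A`: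
its positive index of inertia minus its negative index of inertia. Zero eigenvalues are ignored. -/
noncomputable def sig {n : ℕ} (A : Matrix (Fin n) (Fin n) ℤ) : ℤ :=
  (sigPos (A.map (Int.cast : ℤ → ℝ)).toQuadraticForm' : ℤ) -
    (sigNeg (A.map (Int.cast : ℤ → ℝ)).toQuadraticForm' : ℤ)

/-- `A` has a complete set of null vectors: `n` is even and there are `n / 2` linearly independent
integer vectors `Λ₁, …` with `Λᵢᵀ A Λⱼ = 0` for all `i, j`. -/
def HasCompleteNullVectors {n : ℕ} (A : Matrix (Fin n) (Fin n) ℤ) : Prop :=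
  ∃ r : ℕ, n = 2 * r ∧ ∃ Λ : Fin r → Fin n → ℤ,
    LinearIndependent ℤ Λ ∧ ∀ i j, Λ i ⬝ᵥ A *ᵥ Λ j = 0

/-- The columns of `V` form a `ℤ`-basis of the set `Ξ` of integer vectors: `V` maps `ℤⁿ`
bijectively onto `Ξ`. -/
def IsLatticeBasis {N n : ℕ} (V : Matrix (Fin N) (Fin n) ℤ) (Ξ : Set (Fin N → ℤ)) : Prop :=
  Function.Injective V.mulVec ∧ Set.range V.mulVec = Ξ

namespace EdgeTheory

variable {N : ℕ} (T : EdgeTheory N)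

/-- The theory is bosonic if `K` has only even diagonal entries. Otherwise it is fermionic. -/
def IsBosonic : Prop := ∀ i, Even (T.K i i)

/-- The theory is fermionic if `K` has at least one odd diagonal entry. -/
def IsFermionic : Prop := ∃ i, Odd (T.K i i)

/-- `Ξ₊`, the lattice of integer vectors that are even under `W`. -/
def XiPlus : Set (Fin N → ℤ) := {Λ | T.W *ᵥ Λ = Λ}

/-- `Ξ₋`, the lattice of integer vectors that are odd under `W`. -/
def XiMinus : Set (Fin N → ℤ) := {Λ | T.W *ᵥ Λ = -Λ}

/-- The restriction `Vᵀ K V` of `K` to the lattice spanned by the columns of `V`. -/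
def restrict {n : ℕ} (V : Matrix (Fin N) (Fin n) ℤ) : Matrix (Fin n) (Fin n) ℤ :=
  Vᵀ * T.K * V

/-- The rational number `lᵀ K⁻¹ l'`. -/
noncomputable def pairing (l l' : Fin N → ℤ) : ℚ :=
  (fun i => (l i : ℚ)) ⬝ᵥ (T.K.map (Int.cast : ℤ → ℚ))⁻¹ *ᵥ (fun i => (l' i : ℚ))

/-- Two anyons are equivalent if they differ by some `K Λ` with `Λ` an integer vector. -/
def Equivalent (l l' : Fin N → ℤ) : Prop := ∃ Λ : Fin N → ℤ, l - l' = T.K *ᵥ Λ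

/-- Lagrangian subgroups, as sets of integer vectors. Bosonic exchange statistics are
required only in the bosonic case. -/
structure IsLagrangian (L : Set (Fin N → ℤ)) : Prop where
  integral : ∀ l ∈ L, ∀ l' ∈ L, ∃ z : ℤ, T.pairing l l' = z
  bosons : T.IsBosonic → ∀ l ∈ L, ∃ z : ℤ, Even z ∧ T.pairing l l = z
  maximal : ∀ l' : Fin N → ℤ, (¬ ∃ l ∈ L, T.Equivalent l' l) →
    ∃ l ∈ L, ¬ ∃ z : ℤ, T.pairing l l' = z

/-- `L` is invariant under the `ℤ₂` symmetry, up to equivalence of anyons. -/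
def IsInvariant (L : Set (Fin N → ℤ)) : Prop :=
  ∀ l ∈ L, ∃ l' ∈ L, T.Equivalent (T.Wᵀ *ᵥ l) l'

end EdgeTheory

/-- `|det A| * 2 ^ |sig A|` is a perfect square. -/
def DetSigIsSquare {n : ℕ} (A : Matrix (Fin n) (Fin n) ℤ) : Prop :=
  IsSquare (A.det.natAbs * 2 ^ (sig A).natAbs)

end ChiralEdge

/-!
Maximality makes `M = K⁻¹ L + ℤ ^ N` a self-dual lattice for the form `K`; it is stable under the
involution `W`, and even in the bosonic case (`overlattice`). Let `M±` be the intersections of `M`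
with the eigenspaces of `W` (`eigenlattice`); over `ℚ` they carry the forms `K±`. For `x` in `M` the
vectors `x ± W x` lie in `M±`, and hence `M±` contains twice its dual
(`two_smul_mem_eigenlattice`). So a Gram matrix `G` of `M±` satisfies `G * H = 2` for an integer
matrix `H`, and `|det G|` is a power of two. Comparing `K` and `K (1 - W)` in a basis adapted to the
eigenspaces shows that both `K±` have signature zero (`sig_restrict_eq_zero`).

Moreover, `|det G|` is a square. In the fermionic case this is the assumption on `det K±`, as the
two determinants differ by a rational square. In the bosonic case `|det G| = 2 ^ a`, where `a` is
the corank of `G` modulo `2`; the size of `G` is even because the signature is zero, and the rank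
of `G` modulo `2` is even because `G` is alternating modulo `2` (`isSquare_det_of_even`).

It remains to show that a symmetric integer matrix `G` of signature zero is hyperbolic over `ℚ` if
`|det G|` is a square prime to all odd primes (`metabolic_of_sig_eq_zero`). The argument takes place
in the Witt group of `ℚ`, which is generated by the classes `⟨n⟩` of one-dimensional forms. Suppose
that `p` is the largest prime in a diagonalization of the class of `G`, and that `p` is odd.
Modulo the classes that involve only primes smaller than `p`, the class `⟨p n⟩` depends only on `n`
modulo `p` (`residueClass_eq_emod`), and as binary forms over `𝔽_p` are universal, at most two
such classes remain (`exists_mk_eq_residue_add_residue`). As `G` is invertible modulo `p`, the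
residue form must be isotropic (`exists_isotropic_mod_of_metabolic`), so that these classes
cancel and `p` can be removed (`mem_smoothClasses_of_succ`). In the end the class of `G` is
`c ⟨1⟩ + d ⟨2⟩`, where `2 ⟨2⟩ = 2 ⟨1⟩`. The determinant shows that `d` is even
(`unary_two_notMem`), and then the signature shows that the class is zero
(`eq_zero_of_matCls_eq_nsmul`).

A subspace of `ℚ ^ n` of half the dimension on which `K±` vanishes has a basis of integer
vectors (`exists_integral_basis`), which is a complete set of null vectors.
-/

namespace WittQ

open LinearMap (BilinForm)
open Module ChiralEdge

/-! ### Metabolic forms and the Witt group of `ℚ` -/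

section Field

variable {k V W U : Type*} [Field k] [AddCommGroup V] [Module k V] [AddCommGroup W] [Module k W]
  [AddCommGroup U] [Module k U]

/-- A bilinear form is metabolic if it vanishes identically on some subspace of half the
dimension. For nondegenerate symmetric forms in characteristic different from two these are the
hyperbolic ones. -/
def Metabolic (B : BilinForm k V) : Prop :=
  ∃ N : Submodule k V, (∀ x ∈ N, ∀ y ∈ N, B x y = 0) ∧ finrank k V = 2 * finrank k N

/-- The orthogonal sum of two bilinear forms. -/
def orthoSum (B : BilinForm k V) (C : BilinForm k W) : BilinForm k (V × W) :=
  B.compl₁₂ (LinearMap.fst k V W) (LinearMap.fst k V W) +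
    C.compl₁₂ (LinearMap.snd k V W) (LinearMap.snd k V W)

@[simp]
lemma orthoSum_apply (B : BilinForm k V) (C : BilinForm k W) (x y : V × W) :
    orthoSum B C x y = B x.1 y.1 + C x.2 y.2 := rfl

lemma Metabolic.of_equiv {B : BilinForm k V} {C : BilinForm k W} (h : Metabolic B) (e : V ≃ₗ[k] W)
    (he : ∀ x y, B x y = 0 → C (e x) (e y) = 0) : Metabolic C := by
  obtain ⟨N, hN, hd⟩ := h
  refine ⟨N.map e.toLinearMap, ?_, ?_⟩
  · rintro _ ⟨x, hx, rfl⟩ _ ⟨y, hy, rfl⟩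
    exact he x y (hN x hx y hy)
  · rw [← e.finrank_eq, hd, LinearEquiv.finrank_map_eq]

lemma metabolic_orthoSum_neg_of_isometry [FiniteDimensional k V] {B : BilinForm k V}
    {C : BilinForm k W} (e : V ≃ₗ[k] W) (he : ∀ x y, C (e x) (e y) = B x y) :
    Metabolic (orthoSum B (-C)) := by
  have : FiniteDimensional k W := e.finiteDimensional
  refine ⟨LinearMap.range (LinearMap.id.prod e.toLinearMap), ?_, ?_⟩
  · rintro _ ⟨x, rfl⟩ _ ⟨y, rfl⟩
    simp [he]
  · rw [LinearMap.finrank_range_of_inj, finrank_prod, ← e.finrank_eq, two_mul]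
    intro x y h
    simpa using congrArg Prod.fst h

lemma finrank_submodule_prod [FiniteDimensional k V] [FiniteDimensional k W] (N : Submodule k V)
    (M : Submodule k W) : finrank k (N.prod M) = finrank k N + finrank k M := by
  rw [← finrank_prod]
  exact LinearEquiv.finrank_eq
    { toFun := fun x => (⟨x.1.1, x.2.1⟩, ⟨x.1.2, x.2.2⟩)
      invFun := fun x => ⟨(x.1.1, x.2.1), x.1.2, x.2.2⟩
      map_add' := fun _ _ => rfl
      map_smul' := fun _ _ => rfl
      left_inv := fun _ => rfl
      right_inv := fun _ => rfl }

lemma Metabolic.orthoSum [FiniteDimensional k V] [FiniteDimensional k W] {B : BilinForm k V}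
    {C : BilinForm k W} (hB : Metabolic B) (hC : Metabolic C) : Metabolic (orthoSum B C) := by
  obtain ⟨N, hN, hd⟩ := hB
  obtain ⟨M, hM, hd'⟩ := hC
  refine ⟨N.prod M, ?_, ?_⟩
  · rintro x hx y hy
    simp [hN _ hx.1 _ hy.1, hM _ hx.2 _ hy.2]
  · rw [finrank_prod, finrank_submodule_prod]
    omega

lemma two_mul_finrank_le_of_isotropic [FiniteDimensional k V] {B : BilinForm k V}
    (hB : B.Nondegenerate) (N : Submodule k V) (hN : ∀ x ∈ N, ∀ y ∈ N, B x y = 0) :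
    2 * finrank k N ≤ finrank k V := by
  have h1 : N ≤ B.orthogonal N := fun x hx y hy => hN y hy x hx
  have h2 := Submodule.finrank_mono h1
  rw [LinearMap.BilinForm.finrank_orthogonal hB] at h2
  have h3 := Submodule.finrank_le N
  omega

lemma orthoSum_isSymm {B : BilinForm k V} {C : BilinForm k W} (hB : B.IsSymm) (hC : C.IsSymm) :
    (orthoSum B C).IsSymm :=
  ⟨fun x y => by simp [hB.eq x.1 y.1, hC.eq x.2 y.2]⟩

lemma nondegenerate_of_isSymm {B : BilinForm k V} (hs : B.IsSymm)
    (h : ∀ x, (∀ y, B x y = 0) → x = 0) : B.Nondegenerate :=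
  ⟨fun x hx => h x hx, fun y hy => h y fun x => by rw [hs.eq]; exact hy x⟩

lemma orthoSum_nondegenerate {B : BilinForm k V} {C : BilinForm k W} (hB : B.IsSymm)
    (hC : C.IsSymm) (hB' : B.Nondegenerate) (hC' : C.Nondegenerate) :
    (orthoSum B C).Nondegenerate := by
  refine nondegenerate_of_isSymm (orthoSum_isSymm hB hC) fun x hx => Prod.ext ?_ ?_
  · exact hB'.1 _ fun y => by simpa using hx (y, 0)
  · exact hC'.1 _ fun y => by simpa using hx (0, y)

/-- Witt cancellation for metabolic forms: a metabolic summand of a metabolic form can be removed.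
If `N` and `M` are the two subspaces of half the dimension, the image in `V` of
`N ⊓ (V × M)` is isotropic, and counting dimensions shows that it is large enough. -/
lemma Metabolic.of_orthoSum [FiniteDimensional k V] [FiniteDimensional k W] {B : BilinForm k V}
    {C : BilinForm k W} (hB : B.IsSymm) (hC : C.IsSymm) (hB' : B.Nondegenerate)
    (hC' : C.Nondegenerate) (h : Metabolic (WittQ.orthoSum B C)) (hM : Metabolic C) :
    Metabolic B := by
  obtain ⟨N, hN, hd⟩ := h
  obtain ⟨M, hM, hd'⟩ := hM
  have hns := orthoSum_nondegenerate hB hC hB' hC'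
  set S : Submodule k (V × W) := N ⊓ Submodule.prod ⊤ M with hS
  set S₀ : Submodule k (V × W) := N ⊓ Submodule.prod ⊥ M with hS₀
  have hle : N ⊔ Submodule.prod ⊤ M ≤ (WittQ.orthoSum B C).orthogonal S₀ := by
    refine sup_le (fun x hx y hy => hN y hy.1 x hx) fun x hx y hy => ?_
    have h1 : y.1 = 0 := by simpa using hy.2.1
    have h2 := hM _ hy.2.2 _ hx.2
    simp [h1, h2]
  have h1 := Submodule.finrank_mono hle
  rw [LinearMap.BilinForm.finrank_orthogonal hns] at h1
  have h2 := Submodule.finrank_sup_add_finrank_inf_eq N (Submodule.prod ⊤ M)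
  rw [finrank_submodule_prod, finrank_top, ← hS] at h2
  have h3 : finrank k (S.map (LinearMap.fst k V W)) + finrank k S₀ = finrank k S := by
    rw [← LinearMap.finrank_range_add_finrank_ker ((LinearMap.fst k V W).domRestrict S),
      LinearMap.range_domRestrict]
    congr 1
    have : S₀ = ((LinearMap.ker (LinearMap.fst k V W)).comap S.subtype).map S.subtype := by
      rw [Submodule.map_comap_subtype]
      ext x
      simp only [hS, hS₀, Submodule.mem_inf, Submodule.mem_prod, LinearMap.mem_ker,
        LinearMap.fst_apply, Submodule.mem_top, Submodule.mem_bot]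
      tauto
    rw [this, LinearMap.ker_domRestrict]
    exact Submodule.finrank_map_subtype_eq _ _
  have hiso : ∀ x ∈ S.map (LinearMap.fst k V W), ∀ y ∈ S.map (LinearMap.fst k V W),
      B x y = 0 := by
    rintro _ ⟨x, hx, rfl⟩ _ ⟨y, hy, rfl⟩
    have := hN x hx.1 y hy.1
    rw [orthoSum_apply, hM _ hx.2.2 _ hy.2.2, add_zero] at this
    exact this
  refine ⟨_, hiso, ?_⟩
  have h4 := two_mul_finrank_le_of_isotropic hB' _ hiso
  have h5 := Submodule.finrank_le S₀
  rw [finrank_prod] at *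
  omega

end Field

/-- A nondegenerate symmetric bilinear space over `ℚ`. -/
structure Space where
  carrier : Type
  [addCommGroup : AddCommGroup carrier]
  [module : Module ℚ carrier]
  [finite : FiniteDimensional ℚ carrier]
  form : BilinForm ℚ carrier
  symm : form.IsSymm
  nondeg : form.Nondegenerate

namespace Space

attribute [instance] addCommGroup module finite

/-- The orthogonal sum of two spaces. -/
def sum (X Y : Space) : Space where
  carrier := X.carrier × Y.carrier
  form := orthoSum X.form Y.form
  symm := orthoSum_isSymm X.symm Y.symm
  nondeg := orthoSum_nondegenerate X.symm Y.symm X.nondeg Y.nondeg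

/-- The space with the opposite form. -/
def neg (X : Space) : Space where
  carrier := X.carrier
  form := -X.form
  symm := X.symm.neg
  nondeg := nondegenerate_of_isSymm X.symm.neg fun x hx =>
    X.nondeg.1 x fun y => by simpa using hx y

/-- The zero space. -/
def zero : Space where
  carrier := PUnit
  form := 0
  symm := ⟨fun _ _ => rfl⟩
  nondeg := nondegenerate_of_isSymm ⟨fun _ _ => rfl⟩ fun _ _ => rfl

/-- Witt equivalence: `X ⊥ -Y` is metabolic. -/
def Rel (X Y : Space) : Prop := Metabolic (X.sum Y.neg).form

lemma Rel.of_isometry {X Y : Space} (e : X.carrier ≃ₗ[ℚ] Y.carrier)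
    (he : ∀ x y, Y.form (e x) (e y) = X.form x y) : X.Rel Y :=
  metabolic_orthoSum_neg_of_isometry e he

lemma Rel.symm {X Y : Space} (h : X.Rel Y) : Y.Rel X := by
  refine Metabolic.of_equiv h (LinearEquiv.prodComm ℚ _ _) ?_
  rintro ⟨x₁, x₂⟩ ⟨y₁, y₂⟩ h
  change X.form x₁ y₁ + -Y.form x₂ y₂ = 0 at h
  change Y.form x₂ y₂ + -X.form x₁ y₁ = 0
  linarith

lemma Rel.trans {X Y Z : Space} (h : X.Rel Y) (h' : Y.Rel Z) : X.Rel Z := by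
  refine Metabolic.of_orthoSum (X.sum Z.neg).symm (Y.sum Y.neg).symm (X.sum Z.neg).nondeg
    (Y.sum Y.neg).nondeg ?_ (Rel.of_isometry (LinearEquiv.refl ℚ _) fun _ _ => rfl)
  refine Metabolic.of_equiv (Metabolic.orthoSum h h')
    ((LinearEquiv.prodProdProdComm ℚ _ _ _ _).trans <|
      ((LinearEquiv.refl ℚ _).prodCongr (LinearEquiv.prodComm ℚ _ _)).trans <|
      LinearEquiv.prodProdProdComm ℚ _ _ _ _) ?_
  rintro ⟨⟨x₁, x₂⟩, x₃, x₄⟩ ⟨⟨y₁, y₂⟩, y₃, y₄⟩ h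
  change (X.form x₁ y₁ + -Y.form x₂ y₂) + (Y.form x₃ y₃ + -Z.form x₄ y₄) = 0 at h
  change (X.form x₁ y₁ + -Z.form x₄ y₄) + (Y.form x₃ y₃ + -Y.form x₂ y₂) = 0
  linarith

instance setoid : Setoid Space where
  r := Rel
  iseqv := ⟨fun _ => Rel.of_isometry (LinearEquiv.refl ℚ _) fun _ _ => rfl, Rel.symm, Rel.trans⟩

lemma Rel.sum {X Y X' Y' : Space} (h : X.Rel X') (h' : Y.Rel Y') :
    (X.sum Y).Rel (X'.sum Y') := by
  refine Metabolic.of_equiv (Metabolic.orthoSum h h') (LinearEquiv.prodProdProdComm ℚ _ _ _ _) ?_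
  rintro ⟨⟨x₁, x₂⟩, x₃, x₄⟩ ⟨⟨y₁, y₂⟩, y₃, y₄⟩ h
  change (X.form x₁ y₁ + -X'.form x₂ y₂) + (Y.form x₃ y₃ + -Y'.form x₄ y₄) = 0 at h
  change (X.form x₁ y₁ + Y.form x₃ y₃) + -(X'.form x₂ y₂ + Y'.form x₄ y₄) = 0
  linarith

lemma Rel.neg {X Y : Space} (h : X.Rel Y) : X.neg.Rel Y.neg := by
  refine Metabolic.of_equiv h (LinearEquiv.refl ℚ _) ?_
  rintro ⟨x₁, x₂⟩ ⟨y₁, y₂⟩ h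
  change X.form x₁ y₁ + -Y.form x₂ y₂ = 0 at h
  change -X.form x₁ y₁ + - -Y.form x₂ y₂ = 0
  linarith

end Space

/-- The Witt group of `ℚ`: nondegenerate symmetric bilinear spaces up to Witt equivalence. -/
def WittGroup : Type 1 := Quotient Space.setoid

/-- The class of a space in the Witt group. -/
def Space.cls (X : Space) : WittGroup := Quotient.mk _ X

lemma Space.cls_eq_of_isometry {X Y : Space} (e : X.carrier ≃ₗ[ℚ] Y.carrier)
    (he : ∀ x y, Y.form (e x) (e y) = X.form x y) : X.cls = Y.cls :=
  Quotient.sound (Space.Rel.of_isometry e he)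

namespace WittGroup

instance : Zero WittGroup := ⟨Space.zero.cls⟩
instance : Add WittGroup := ⟨Quotient.map₂ Space.sum fun _ _ h _ _ h' => Space.Rel.sum h h'⟩
instance : Neg WittGroup := ⟨Quotient.map Space.neg fun _ _ h => Space.Rel.neg h⟩

lemma cls_neg (X : Space) : X.neg.cls = -X.cls := rfl

lemma cls_eq_zero_iff (X : Space) : X.cls = 0 ↔ Metabolic X.form := by
  constructor
  · intro h
    have h : X.Rel Space.zero := Quotient.exact h
    refine Metabolic.of_equiv h (LinearEquiv.prodUnique (R := ℚ) (M₂ := PUnit)) ?_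
    rintro ⟨x, x'⟩ ⟨y, y'⟩ h
    change X.form x y + -0 = 0 at h
    change X.form x y = 0
    linarith
  · intro h
    refine Quotient.sound ?_
    refine Metabolic.of_equiv h (LinearEquiv.prodUnique (R := ℚ) (M₂ := PUnit)).symm ?_
    intro x y h
    change X.form x y + -0 = 0
    linarith

instance : AddCommGroup WittGroup where
  add_assoc := by
    rintro ⟨X⟩ ⟨Y⟩ ⟨Z⟩
    exact Space.cls_eq_of_isometry (X := (X.sum Y).sum Z) (Y := X.sum (Y.sum Z))
      (LinearEquiv.prodAssoc ℚ _ _ _) fun x y => (add_assoc _ _ _).symm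
  zero_add := by
    rintro ⟨X⟩
    exact Space.cls_eq_of_isometry (X := Space.zero.sum X) (Y := X)
      (LinearEquiv.uniqueProd (R := ℚ) (M₂ := PUnit)) fun x y => (zero_add _).symm
  add_zero := by
    rintro ⟨X⟩
    exact Space.cls_eq_of_isometry (X := X.sum Space.zero) (Y := X)
      (LinearEquiv.prodUnique (R := ℚ) (M₂ := PUnit)) fun x y => (add_zero _).symm
  add_comm := by
    rintro ⟨X⟩ ⟨Y⟩
    exact Space.cls_eq_of_isometry (X := X.sum Y) (Y := Y.sum X)
      (LinearEquiv.prodComm ℚ _ _) fun x y => add_comm _ _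
  neg_add_cancel := by
    rintro ⟨X⟩
    refine (cls_eq_zero_iff (X.neg.sum X)).2 <| Metabolic.of_equiv (Setoid.refl X : X.Rel X)
      (LinearEquiv.prodComm ℚ _ _) ?_
    rintro ⟨x₁, x₂⟩ ⟨y₁, y₂⟩ h
    change X.form x₁ y₁ + -X.form x₂ y₂ = 0 at h
    change -X.form x₂ y₂ + X.form x₁ y₁ = 0
    linarith
  nsmul := nsmulRec
  zsmul := zsmulRec

end WittGroup

/-! ### Witt classes of matrices -/

section MatrixClass

lemma toBilin'_isSymm {R ι : Type*} [CommRing R] [Fintype ι] [DecidableEq ι]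
    {A : Matrix ι ι R} (hA : A.IsSymm) : (toBilin' A).IsSymm :=
  ⟨fun x y => by
    rw [Matrix.toBilin'_apply', Matrix.toBilin'_apply', dotProduct_mulVec, ← mulVec_transpose,
      hA.eq, dotProduct_comm]⟩

variable {ι κ : Type} [Fintype ι] [DecidableEq ι] [Fintype κ] [DecidableEq κ]

/-- The bilinear space on `ι → ℚ` with a given symmetric invertible Gram matrix. -/
def Space.ofMatrix (A : Matrix ι ι ℚ) (hA : A.IsSymm) (hd : A.det ≠ 0) : Space where
  carrier := ι → ℚ
  form := toBilin' A
  symm := toBilin'_isSymm hA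
  nondeg := LinearMap.BilinForm.nondegenerate_toBilin'_of_det_ne_zero' A hd

/-- The Witt class of the space with Gram matrix `A`. The value `0` for matrices that are not
symmetric or not invertible keeps `A` free of side conditions; for `A = (0)` it is also the class of
the form modulo its radical. -/
noncomputable def matCls (A : Matrix ι ι ℚ) : WittGroup :=
  open scoped Classical in
  if h : A.IsSymm ∧ A.det ≠ 0 then (Space.ofMatrix A h.1 h.2).cls else 0

lemma matCls_of {A : Matrix ι ι ℚ} (hA : A.IsSymm) (hd : A.det ≠ 0) :
    matCls A = (Space.ofMatrix A hA hd).cls :=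
  dif_pos ⟨hA, hd⟩

lemma matCls_eq_zero_iff {A : Matrix ι ι ℚ} (hA : A.IsSymm) (hd : A.det ≠ 0) :
    matCls A = 0 ↔ Metabolic (toBilin' A) := by
  rw [matCls_of hA hd, WittGroup.cls_eq_zero_iff]
  rfl

lemma matCls_congruence {A P : Matrix ι ι ℚ} (hA : A.IsSymm) (hd : A.det ≠ 0) (hP : P.det ≠ 0) :
    matCls (Pᵀ * A * P) = matCls A := by
  have h1 : (Pᵀ * A * P).IsSymm := by
    simp [Matrix.IsSymm, Matrix.mul_assoc, hA.eq]
  have h2 : (Pᵀ * A * P).det ≠ 0 := by simp [hP, hd]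
  rw [matCls_of hA hd, matCls_of h1 h2]
  refine Space.cls_eq_of_isometry
    (X := Space.ofMatrix _ h1 h2) (Y := Space.ofMatrix A hA hd)
    (Matrix.toLinearEquiv' P (P.invertibleOfIsUnitDet (isUnit_iff_ne_zero.2 hP))) ?_
  intro (x : ι → ℚ) (y : ι → ℚ)
  change toBilin' A (P *ᵥ x) (P *ᵥ y) = toBilin' (Pᵀ * A * P) x y
  rw [Matrix.toBilin'_apply', Matrix.toBilin'_apply', ← Matrix.mulVec_mulVec,
    ← Matrix.mulVec_mulVec, Matrix.dotProduct_mulVec x Pᵀ, Matrix.vecMul_transpose]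

lemma matCls_reindex {A : Matrix ι ι ℚ} (hA : A.IsSymm) (hd : A.det ≠ 0) (e : ι ≃ κ) :
    matCls (A.submatrix e.symm e.symm) = matCls A := by
  have h1 : (A.submatrix e.symm e.symm).IsSymm := hA.submatrix _
  have h2 : (A.submatrix e.symm e.symm).det ≠ 0 := by simpa using hd
  rw [matCls_of hA hd, matCls_of h1 h2]
  refine Space.cls_eq_of_isometry
    (X := Space.ofMatrix _ h1 h2) (Y := Space.ofMatrix A hA hd)
    (LinearEquiv.funCongrLeft ℚ ℚ e) ?_
  intro (x : κ → ℚ) (y : κ → ℚ)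
  change toBilin' A (x ∘ e) (y ∘ e) = toBilin' (A.submatrix e.symm e.symm) x y
  rw [Matrix.toBilin'_apply', Matrix.toBilin'_apply', Matrix.submatrix_mulVec_equiv,
    Equiv.symm_symm, dotProduct_comp_equiv_symm]

lemma matCls_fromBlocks {A : Matrix ι ι ℚ} {B : Matrix κ κ ℚ} (hA : A.IsSymm) (hd : A.det ≠ 0)
    (hB : B.IsSymm) (hd' : B.det ≠ 0) :
    matCls (fromBlocks A 0 0 B) = matCls A + matCls B := by
  have h1 : (fromBlocks A 0 0 B).IsSymm := by
    simp [Matrix.IsSymm, fromBlocks_transpose, hA.eq, hB.eq]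
  have h2 : (fromBlocks A 0 0 B).det ≠ 0 := by simp [hd, hd']
  rw [matCls_of hA hd, matCls_of hB hd', matCls_of h1 h2]
  refine Space.cls_eq_of_isometry
    (X := Space.ofMatrix _ h1 h2) (Y := (Space.ofMatrix A hA hd).sum (Space.ofMatrix B hB hd'))
    (LinearEquiv.sumArrowLequivProdArrow ι κ ℚ ℚ) ?_
  intro (x : ι ⊕ κ → ℚ) (y : ι ⊕ κ → ℚ)
  change toBilin' A (x ∘ Sum.inl) (y ∘ Sum.inl) + toBilin' B (x ∘ Sum.inr) (y ∘ Sum.inr) =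
    toBilin' (fromBlocks A 0 0 B) x y
  rw [Matrix.toBilin'_apply', Matrix.toBilin'_apply', Matrix.toBilin'_apply',
    Matrix.fromBlocks_mulVec]
  simp [dotProduct, Fintype.sum_sum_type]

lemma matCls_neg {A : Matrix ι ι ℚ} (hA : A.IsSymm) (hd : A.det ≠ 0) :
    matCls (-A) = -matCls A := by
  have h2 : (-A).det ≠ 0 := by simp [Matrix.det_neg, hd]
  rw [matCls_of hA hd, matCls_of hA.neg h2, ← WittGroup.cls_neg]
  refine Space.cls_eq_of_isometry
    (X := Space.ofMatrix _ hA.neg h2) (Y := (Space.ofMatrix A hA hd).neg)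
    (LinearEquiv.refl ℚ _) ?_
  intro (x : ι → ℚ) (y : ι → ℚ)
  change -toBilin' A x y = toBilin' (-A) x y
  simp

end MatrixClass

/-- The class `⟨a⟩` of the one-dimensional form `a * x * y`; it is `0` for `a = 0`. -/
noncomputable def unary (a : ℚ) : WittGroup := matCls (diagonal fun _ : Unit => a)

lemma unary_zero : unary 0 = 0 := by
  rw [unary, matCls, dif_neg]
  simp

lemma unary_mul_sq (a : ℚ) {s : ℚ} (hs : s ≠ 0) : unary (a * s ^ 2) = unary a := by
  rcases eq_or_ne a 0 with rfl | ha
  · simp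
  rw [unary, unary, ← matCls_congruence (P := diagonal fun _ : Unit => s)
    (isSymm_diagonal fun _ : Unit => a) (by simpa using ha) (by simpa using hs)]
  congr 1
  simp only [diagonal_transpose, diagonal_mul_diagonal]
  congr 1
  ext
  ring

lemma unary_neg (a : ℚ) : unary (-a) = -unary a := by
  rcases eq_or_ne a 0 with rfl | ha
  · simp [unary_zero]
  rw [unary, unary, ← matCls_neg (isSymm_diagonal fun _ : Unit => a) (by simpa using ha)]
  congr 1

/-- If `a + b ≠ 0`, the forms `diag(a, b)` and `diag(a + b, ab(a + b))` are isometric. -/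
lemma unary_add (a b : ℚ) : unary a + unary b = unary (a + b) + unary (a * b * (a + b)) := by
  rcases eq_or_ne a 0 with rfl | ha
  · simp [unary_zero]
  rcases eq_or_ne b 0 with rfl | hb
  · simp [unary_zero]
  rcases eq_or_ne (a + b) 0 with hab | hab
  · obtain rfl : b = -a := by linarith
    simp [unary_zero, unary_neg]
  have hs (c : ℚ) : (diagonal fun _ : Unit => c).IsSymm := isSymm_diagonal _
  unfold unary
  rw [← matCls_fromBlocks (hs _) (by simpa using ha) (hs _) (by simpa using hb),
    ← matCls_fromBlocks (hs _) (by simpa using hab) (hs _) (by simp [ha, hb, hab])]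
  -- The vectors `(1, 1)` and `(-b, a)` are orthogonal for the form `diag(a, b)`.
  let P : Matrix (Unit ⊕ Unit) (Unit ⊕ Unit) ℚ :=
    fromBlocks 1 (diagonal fun _ => -b) 1 (diagonal fun _ => a)
  have hP : P.det = a + b := by
    rw [det_fromBlocks_one₁₁, Matrix.one_mul, diagonal_sub]
    simp
  rw [← matCls_congruence (P := P) _ _ (by rwa [hP])]
  · congr 1
    simp only [P, fromBlocks_transpose]
    rw [fromBlocks_multiply, fromBlocks_multiply]
    ext (i | i) (j | j) <;> simp <;> ring
  · simp [Matrix.IsSymm]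
  · simp [ha, hb]

lemma matCls_diagonal {ι : Type} [Fintype ι] [DecidableEq ι] (d : ι → ℚ) (hd : ∀ i, d i ≠ 0) :
    matCls (diagonal d) = ∑ i, unary (d i) := by
  revert d
  refine Fintype.induction_empty_option
    (P := fun ι _ => ∀ [DecidableEq ι] (d : ι → ℚ), (∀ i, d i ≠ 0) →
      matCls (diagonal d) = ∑ i, unary (d i)) ?_ ?_ ?_ ι
  · intro α β _ e ih _ d hd
    have : DecidableEq α := e.decidableEq
    let : Fintype α := Fintype.ofEquiv β e.symm
    have h := ih (d ∘ e) fun i => hd _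
    rw [← matCls_reindex (isSymm_diagonal _)
      (by simpa [det_diagonal, Finset.prod_ne_zero_iff] using fun i => hd (e i)) e] at h
    convert h using 1
    · congr 1
      ext i j
      simp [diagonal_apply]
    · exact (Equiv.sum_comp e fun i => unary (d i)).symm
  · intro _ d _
    rw [Finset.univ_eq_empty, Finset.sum_empty, matCls_eq_zero_iff (isSymm_diagonal _) (by simp)]
    · exact ⟨⊥, by simp, by simp⟩
  · intro α _ ih _ d hd
    have : DecidableEq α := Classical.decEq _
    rw [Fintype.sum_option, ← ih _ fun i => hd _, unary, add_comm,
      ← matCls_fromBlocks (isSymm_diagonal _)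
        (by simpa [det_diagonal, Finset.prod_ne_zero_iff] using fun i => hd (some i))
        (isSymm_diagonal _) (by simpa using hd none),
      ← matCls_reindex (isSymm_diagonal d)
        (by rw [det_diagonal]; exact Finset.prod_ne_zero_iff.2 fun i _ => hd i)
        (Equiv.optionEquivSumPUnit α)]
    congr 1
    ext (i | i) (j | j) <;> simp [diagonal_apply]

/-- Every class is a sum of classes of one-dimensional forms, because symmetric bilinear forms over
`ℚ` can be diagonalized. -/
lemma closure_unary_eq_top : AddSubgroup.closure (Set.range fun n : ℤ => unary n) = ⊤ := by
  rw [eq_top_iff]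
  rintro ⟨X⟩ -
  change X.cls ∈ _
  obtain ⟨v, hv⟩ :=
    LinearMap.BilinForm.exists_orthogonal_basis (LinearMap.BilinForm.isSymm_iff.1 X.symm)
  have hd : ∀ i, X.form (v i) (v i) ≠ 0 := fun i =>
    LinearMap.BilinForm.iIsOrtho.not_isOrtho_basis_self_of_nondegenerate hv X.nondeg i
  have hX : X.cls = matCls (diagonal fun i => X.form (v i) (v i)) := by
    have h1 : (diagonal fun i => X.form (v i) (v i)).IsSymm := isSymm_diagonal _
    have h2 : (diagonal fun i => X.form (v i) (v i)).det ≠ 0 := by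
      simpa [det_diagonal, Finset.prod_ne_zero_iff] using hd
    rw [matCls_of h1 h2]
    refine Space.cls_eq_of_isometry (Y := Space.ofMatrix _ h1 h2) v.equivFun ?_
    intro x y
    change toBilin' (diagonal fun i => X.form (v i) (v i)) (v.equivFun x) (v.equivFun y) = _
    have : LinearMap.BilinForm.toMatrix v X.form = diagonal fun i => X.form (v i) (v i) := by
      ext i j
      rw [LinearMap.BilinForm.toMatrix_apply, diagonal_apply]
      split_ifs with h
      · rw [h]
      · exact hv h
    rw [← this, Matrix.toBilin'_apply', LinearMap.BilinForm.dotProduct_toMatrix_mulVec,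
      LinearEquiv.symm_apply_apply, LinearEquiv.symm_apply_apply]
  rw [hX, matCls_diagonal _ hd]
  refine sum_mem fun i _ => AddSubgroup.subset_closure ⟨(X.form (v i) (v i)).num *
    (X.form (v i) (v i)).den, ?_⟩
  set q := X.form (v i) (v i)
  have hq : (q.den : ℚ) ≠ 0 := by exact_mod_cast q.den_ne_zero
  change unary _ = unary q
  rw [← unary_mul_sq q hq]
  congr 1
  push_cast
  rw [← Rat.mul_den_eq_num q]
  ring

lemma det_map_intCast {ι R : Type*} [Fintype ι] [DecidableEq ι] [CommRing R] (G : Matrix ι ι ℤ) :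
    (G.map (Int.cast : ℤ → R)).det = G.det :=
  ((Int.castRingHom R).map_det G).symm

lemma det_map_intCast_ne_zero {ι : Type*} [Fintype ι] [DecidableEq ι] {G : Matrix ι ι ℤ}
    (hd : G.det ≠ 0) : (G.map (Int.cast : ℤ → ℚ)).det ≠ 0 := by
  rw [det_map_intCast]
  exact_mod_cast hd

/-- The Witt classes of integer matrices whose determinant has absolute value in `S`. -/
noncomputable def integralClasses (S : Submonoid ℕ) : AddSubgroup WittGroup where
  carrier := {w | ∃ (ι : Type) (_ : Fintype ι) (_ : DecidableEq ι) (G : Matrix ι ι ℤ),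
    G.IsSymm ∧ G.det ≠ 0 ∧ G.det.natAbs ∈ S ∧ matCls (G.map (Int.cast : ℤ → ℚ)) = w}
  zero_mem' := by
    refine ⟨Empty, inferInstance, inferInstance, 0, rfl, by simp, by simp [S.one_mem], ?_⟩
    rw [matCls_eq_zero_iff (Subsingleton.elim _ _) (by simp)]
    exact ⟨⊥, by simp, by simp⟩
  add_mem' := by
    rintro _ _ ⟨ι, _, _, G, hG, hd, hS, rfl⟩ ⟨κ, _, _, G', hG', hd', hS', rfl⟩
    refine ⟨ι ⊕ κ, inferInstance, inferInstance, fromBlocks G 0 0 G', ?_, by simp [hd, hd'], ?_, ?_⟩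
    · simp [Matrix.IsSymm, fromBlocks_transpose, hG.eq, hG'.eq]
    · rw [det_fromBlocks_zero₁₂, Int.natAbs_mul]
      exact S.mul_mem hS hS'
    · rw [← matCls_fromBlocks (hG.map _) (det_map_intCast_ne_zero hd) (hG'.map _)
        (det_map_intCast_ne_zero hd'), fromBlocks_map]
      simp
  neg_mem' := by
    rintro _ ⟨ι, _, _, G, hG, hd, hS, rfl⟩
    refine ⟨ι, inferInstance, inferInstance, -G, hG.neg, by simp [det_neg, hd], ?_, ?_⟩
    · simpa [det_neg, Int.natAbs_mul, Int.natAbs_pow] using hS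
    · rw [← matCls_neg (hG.map _) (det_map_intCast_ne_zero hd)]
      congr 1

lemma unary_mem_integralClasses {S : Submonoid ℕ} {n : ℤ} (hn : n ≠ 0) (hS : n.natAbs ∈ S) :
    unary n ∈ integralClasses S := by
  refine ⟨Unit, inferInstance, inferInstance, diagonal fun _ => n, isSymm_diagonal _, by simpa,
    by simpa, ?_⟩
  simp [unary, diagonal_map]

/-! ### Isotropic vectors modulo a prime -/

section Lattice

variable {ι : Type*}

/-- The inclusion of integer vectors into rational vectors. -/
def castVec (ι : Type*) : (ι → ℤ) →ₗ[ℤ] (ι → ℚ) :=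
  (Int.castAddHom ℚ).toIntLinearMap.compLeft ι

@[simp]
lemma castVec_apply (x : ι → ℤ) (i : ι) : castVec ι x i = x i := rfl

lemma castVec_single [DecidableEq ι] (i : ι) :
    castVec ι (Pi.single i 1) = Pi.single i 1 := by
  ext j
  rcases eq_or_ne j i with rfl | h <;> simp [*]

lemma castVec_injective : Function.Injective (castVec ι) := fun x y h => by
  ext i
  have := congrFun h i
  simpa using this

lemma exists_smul_eq_castVec [Finite ι] (x : ι → ℚ) :
    ∃ d : ℤ, d ≠ 0 ∧ ∃ z : ι → ℤ, castVec ι z = d • x := by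
  classical
  obtain ⟨d, hd⟩ := IsLocalization.exist_integer_multiples_of_finite (nonZeroDivisors ℤ) x
  refine ⟨d, nonZeroDivisors.coe_ne_zero d, ?_⟩
  choose z hz using hd
  exact ⟨z, funext fun i => by simpa using hz i⟩

lemma linearIndependent_castVec [Finite ι] {κ : Type*} {Λ : κ → ι → ℤ} (h : LinearIndependent ℤ Λ) :
    LinearIndependent ℚ fun k => castVec ι (Λ k) := by
  rw [← LinearIndependent.iff_fractionRing ℤ ℚ]
  exact h.map' (castVec ι) (LinearMap.ker_eq_bot.2 castVec_injective)

/-- A subspace of `ℚ^ι` has a basis made of integer vectors that is also a `ℤ`-basis of the lattice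
of all integer vectors in the subspace. -/
lemma exists_integral_basis [Finite ι] (N : Submodule ℚ (ι → ℚ)) :
    ∃ Λ : Fin (finrank ℚ N) → ι → ℤ, LinearIndependent ℤ Λ ∧ (∀ k, castVec ι (Λ k) ∈ N) ∧
      ∀ z, castVec ι z ∈ N → z ∈ Submodule.span ℤ (Set.range Λ) := by
  set L : Submodule ℤ (ι → ℤ) := (N.restrictScalars ℤ).comap (castVec ι) with hL
  let b := Module.finBasis ℤ L
  have hli : LinearIndependent ℤ fun k => (b k : ι → ℤ) :=
    b.linearIndependent.map' L.subtype L.ker_subtype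
  have hspan : ∀ z, castVec ι z ∈ N →
      z ∈ Submodule.span ℤ (Set.range fun k => (b k : ι → ℤ)) := by
    intro z hz
    have h1 : (⟨z, hz⟩ : L) ∈ Submodule.span ℤ (Set.range b) := by simp [b.span_eq]
    have h2 := Submodule.mem_map_of_mem (f := L.subtype) h1
    rwa [Submodule.map_span, ← Set.range_comp] at h2
  have hNspan : Submodule.span ℚ (Set.range fun k => castVec ι (b k)) = N := by
    refine le_antisymm (Submodule.span_le.2 ?_) ?_
    · rintro _ ⟨k, rfl⟩
      exact (b k).2
    · intro x hx
      obtain ⟨d, hd, z, hz⟩ := exists_smul_eq_castVec x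
      have hzN : castVec ι z ∈ N := by
        rw [hz]
        exact (N.restrictScalars ℤ).smul_mem d hx
      have h3 := Submodule.mem_map_of_mem (f := castVec ι) (hspan z hzN)
      rw [Submodule.map_span, ← Set.range_comp] at h3
      have h4 := Submodule.span_le_restrictScalars ℤ ℚ _ h3
      rw [hz, ← Int.cast_smul_eq_zsmul ℚ] at h4
      exact (Submodule.smul_mem_iff _ (by exact_mod_cast hd)).1 h4
  have hrank : finrank ℚ N = finrank ℤ L := by
    rw [← hNspan, finrank_span_eq_card (linearIndependent_castVec hli), Fintype.card_fin]
  rw [hrank]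
  exact ⟨_, hli, fun k => (b k).2, hspan⟩

/-- The reductions modulo `p` of the vectors of an integral basis of a subspace
are linearly independent. -/
lemma linearIndependent_mod {p : ℕ} [Fact p.Prime] {N : Submodule ℚ (ι → ℚ)} {κ : Type*}
    [Finite κ] {Λ : κ → ι → ℤ} (hli : LinearIndependent ℤ Λ) (hN : ∀ k, castVec ι (Λ k) ∈ N)
    (hspan : ∀ z, castVec ι z ∈ N → z ∈ Submodule.span ℤ (Set.range Λ)) :
    LinearIndependent (ZMod p) fun k => ((fun i => (Λ k i : ZMod p)) : ι → ZMod p) := by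
  have := Fintype.ofFinite κ
  have hp : (p : ℤ) ≠ 0 := by exact_mod_cast (Fact.out : p.Prime).ne_zero
  rw [Fintype.linearIndependent_iff]
  intro c hc k
  choose g hg using fun k => ZMod.intCast_surjective (c k)
  have h1 : ∀ i, (p : ℤ) ∣ ∑ k, g k * Λ k i := by
    intro i
    rw [← ZMod.intCast_zmod_eq_zero_iff_dvd _ p]
    have := congrFun hc i
    simpa [hg] using this
  choose z hz using h1
  have h2 : ∑ k, g k • Λ k = (p : ℤ) • z := by
    ext i
    simpa using hz i
  have h3 : castVec ι z ∈ N := by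
    have h4 : castVec ι ((p : ℤ) • z) ∈ N := by
      rw [← h2, map_sum]
      refine sum_mem fun k _ => ?_
      rw [map_smul]
      exact (N.restrictScalars ℤ).smul_mem _ (hN k)
    rw [map_smul, ← Int.cast_smul_eq_zsmul ℚ] at h4
    exact (Submodule.smul_mem_iff _ (by exact_mod_cast hp)).1 h4
  obtain ⟨d, hd⟩ := (Submodule.mem_span_range_iff_exists_fun ℤ).1 (hspan z h3)
  have h5 : ∑ k, (g k - p * d k) • Λ k = 0 := by
    rw [← sub_eq_zero.2 h2, ← hd, Finset.smul_sum, ← Finset.sum_sub_distrib]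
    exact Finset.sum_congr rfl fun k _ => by rw [sub_smul, mul_smul]
  have h6 := Fintype.linearIndependent_iff.1 hli _ h5 k
  rw [← hg, sub_eq_zero.1 h6]
  simp

end Lattice

/-- Let `G` be an integer matrix that is invertible modulo `p`. If `G ⊥ p * diag(u)` is metabolic
over `ℚ`, then the quadratic form `diag(u)` has a nontrivial zero modulo `p`. For dimension
reasons, the reduction modulo `p` of the integer points of a subspace of half the dimension cannot
be injected into the nondegenerate part, so that some integer isotropic vector is
nonzero modulo `p` although its `G`-component is divisible by `p`. -/
theorem exists_isotropic_mod_of_metabolic {ι κ : Type} [Fintype ι] [DecidableEq ι] [Fintype κ]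
    [DecidableEq κ] [Nonempty κ] {p : ℕ} [Fact p.Prime] {G : Matrix ι ι ℤ}
    (hp : (G.det : ZMod p) ≠ 0) (u : κ → ℤ)
    (h : Metabolic (toBilin' (fromBlocks (G.map (Int.cast : ℤ → ℚ)) 0 0
      (diagonal fun k => (p * u k : ℚ))))) :
    ∃ v : κ → ℤ, (∃ k, (v k : ZMod p) ≠ 0) ∧ (p : ℤ) ∣ ∑ k, u k * v k ^ 2 := by
  obtain ⟨N, hN, hd⟩ := h
  obtain ⟨Λ, hli, hΛN, hspan⟩ := exists_integral_basis N
  have hmod := linearIndependent_mod (p := p) hli hΛN hspan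
  have hform : ∀ x y : ι ⊕ κ → ℤ, castVec _ x ∈ N → castVec _ y ∈ N →
      (fun i => x (.inl i)) ⬝ᵥ G *ᵥ (fun i => y (.inl i)) +
        p * ∑ k, u k * (x (.inr k) * y (.inr k)) = 0 := by
    intro x y hx hy
    have h1 := hN _ hx _ hy
    rw [Matrix.toBilin'_apply', fromBlocks_mulVec] at h1
    simp only [dotProduct, Fintype.sum_sum_type, Sum.elim_inl, Sum.elim_inr,
      Matrix.zero_mulVec, add_zero, zero_add, mulVec, castVec_apply, Function.comp_apply,
      map_apply] at h1 ⊢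
    have h2 : (((∑ i, x (.inl i) * ∑ j, G i j * y (.inl j)) +
        p * ∑ k, u k * (x (.inr k) * y (.inr k)) : ℤ) : ℚ) = 0 := by
      push_cast
      rw [← h1, Finset.mul_sum]
      congr 1
      exact Finset.sum_congr rfl fun k _ => by simp [diagonal_apply]; ring
    exact_mod_cast h2
  let F := ZMod p
  let c : (ι ⊕ κ → F) →ₗ[F] (ι → F) := LinearMap.funLeft F F Sum.inl
  set S : Submodule F (ι ⊕ κ → F) := Submodule.span F (Set.range fun k i => (Λ k i : F)) with hS
  have hSrank : finrank F S = finrank ℚ N := by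
    rw [hS, finrank_span_eq_card hmod, Fintype.card_fin]
  have hlift : ∀ s ∈ S, ∃ z : ι ⊕ κ → ℤ, castVec _ z ∈ N ∧ ∀ i, (z i : F) = s i := by
    intro s hs
    obtain ⟨a, ha⟩ := (Submodule.mem_span_range_iff_exists_fun F).1 hs
    choose g hg using fun k => ZMod.intCast_surjective (a k)
    refine ⟨∑ k, g k • Λ k, ?_, fun i => ?_⟩
    · rw [map_sum]
      refine sum_mem fun k _ => ?_
      rw [map_smul]
      exact (N.restrictScalars ℤ).smul_mem _ (hΛN k)
    · rw [← ha]
      simp [hg, F]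
  have hker : ∃ s ∈ S, c s = 0 ∧ s ≠ 0 := by
    by_contra! hcon
    have hinj : LinearMap.ker (c.domRestrict S) = ⊥ := by
      rw [LinearMap.ker_eq_bot']
      intro s hs
      exact Subtype.ext (hcon s s.2 hs)
    have h1 := LinearMap.finrank_range_of_inj (LinearMap.ker_eq_bot.1 hinj)
    rw [LinearMap.range_domRestrict] at h1
    have hGF : (G.map (Int.cast : ℤ → F)).det ≠ 0 := by rwa [det_map_intCast]
    have h2 := two_mul_finrank_le_of_isotropic
      (LinearMap.BilinForm.nondegenerate_toBilin'_of_det_ne_zero' _ hGF) (S.map c) (by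
        rintro _ ⟨s, hs, rfl⟩ _ ⟨t, ht, rfl⟩
        obtain ⟨x, hx, hxs⟩ := hlift s hs
        obtain ⟨y, hy, hyt⟩ := hlift t ht
        have h3 := congrArg (Int.cast : ℤ → F) (hform x y hx hy)
        rw [Matrix.toBilin'_apply']
        simp only [dotProduct, mulVec, map_apply, c, LinearMap.funLeft_apply, ← hxs, ← hyt] at h3 ⊢
        push_cast at h3
        simpa [F] using h3)
    rw [h1, hSrank] at h2
    rw [finrank_fintype_fun_eq_card, Fintype.card_sum] at hd
    rw [finrank_fintype_fun_eq_card] at h2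
    have := Fintype.card_pos (α := κ)
    omega
  obtain ⟨s, hs, hcs, hs0⟩ := hker
  obtain ⟨z, hz, hzs⟩ := hlift s hs
  have h1 : ∀ i, (p : ℤ) ∣ z (.inl i) := fun i => by
    rw [← ZMod.intCast_zmod_eq_zero_iff_dvd _ p]
    exact (hzs _).trans (congrFun hcs i)
  choose y hy using h1
  refine ⟨fun k => z (.inr k), ?_, ?_⟩
  · by_contra! hcon
    refine hs0 (funext fun i => ?_)
    rcases i with i | k
    · exact congrFun hcs i
    · exact (hzs _).symm.trans (hcon k)
  · have h2 := hform z z hz hz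
    have h3 : (fun i => z (.inl i)) = (p : ℤ) • y := funext hy
    rw [h3, mulVec_smul, dotProduct_smul, smul_dotProduct, smul_eq_mul, smul_eq_mul,
      ← mul_add] at h2
    have hp0 : (p : ℤ) ≠ 0 := by exact_mod_cast (Fact.out : p.Prime).ne_zero
    have h4 := (mul_eq_zero.1 h2).resolve_left hp0
    refine ⟨-(y ⬝ᵥ G *ᵥ y), ?_⟩
    simp only [sq]
    linarith

/-! ### Descent over the primes -/

/-- The natural numbers prime to `p`. A class in `integralClasses (primeTo p)` is represented by a
form that is unimodular at `p`. -/
def primeTo (p : ℕ) : Submonoid ℕ where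
  carrier := {n | n.Coprime p}
  one_mem' := Nat.coprime_one_left p
  mul_mem' := Nat.Coprime.mul_left

/-- If the class of `p * diag(u)` is represented by a matrix that is invertible modulo `p`, then
`diag(u)` is isotropic modulo `p`. -/
lemma exists_isotropic_mod_of_mem {κ : Type} [Fintype κ] [DecidableEq κ] [Nonempty κ] {p : ℕ}
    [Fact p.Prime] {u : κ → ℤ} (hu : ∀ k, u k ≠ 0)
    (h : ∑ k, unary (p * u k) ∈ integralClasses (primeTo p)) :
    ∃ v : κ → ℤ, (∃ k, (v k : ZMod p) ≠ 0) ∧ (p : ℤ) ∣ ∑ k, u k * v k ^ 2 := by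
  obtain ⟨ι, _, _, G, hG, hd, hS, hw⟩ := (integralClasses (primeTo p)).neg_mem h
  have hp0 : (p : ℚ) ≠ 0 := by exact_mod_cast (Fact.out : p.Prime).ne_zero
  have hpu : ∀ k, (p * u k : ℚ) ≠ 0 := fun k => mul_ne_zero hp0 (by exact_mod_cast hu k)
  have hdet : (diagonal fun k => (p * u k : ℚ)).det ≠ 0 := by
    rw [det_diagonal]
    exact Finset.prod_ne_zero_iff.2 fun k _ => hpu k
  refine exists_isotropic_mod_of_metabolic (G := G) ?_ u ?_
  · rw [Ne, ZMod.intCast_zmod_eq_zero_iff_dvd, Int.natCast_dvd]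
    exact (Fact.out : p.Prime).coprime_iff_not_dvd.1 (Nat.Coprime.symm hS)
  · have hs : (fromBlocks (G.map (Int.cast : ℤ → ℚ)) 0 0
        (diagonal fun k => (p * u k : ℚ))).IsSymm := by
      simp [Matrix.IsSymm, fromBlocks_transpose, (hG.map (Int.cast : ℤ → ℚ)).eq]
    rw [← matCls_eq_zero_iff hs (by simpa using ⟨det_map_intCast_ne_zero hd, by simpa using hdet⟩),
      matCls_fromBlocks (hG.map _) (det_map_intCast_ne_zero hd) (isSymm_diagonal _) hdet, hw,
      matCls_diagonal _ hpu, neg_add_cancel]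

/-- The subgroup of the Witt group generated by the classes `⟨n⟩`, where `n` is an integer all of
whose prime factors are smaller than `p`. -/
noncomputable def smoothClasses (p : ℕ) : AddSubgroup WittGroup :=
  AddSubgroup.closure {w | ∃ n : ℤ, n.natAbs ∈ Nat.smoothNumbers p ∧ unary n = w}

lemma unary_mem_smoothClasses {p : ℕ} {n : ℤ} (hn : n.natAbs ∈ Nat.smoothNumbers p) :
    unary n ∈ smoothClasses p :=
  AddSubgroup.subset_closure ⟨n, hn, rfl⟩

lemma natAbs_mem_smoothNumbers_of_lt {p : ℕ} {n : ℤ} (h0 : n ≠ 0) (h : |n| < p) :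
    n.natAbs ∈ Nat.smoothNumbers p :=
  Nat.mem_smoothNumbers_of_lt (Int.natAbs_pos.2 h0)
    (by rw [Int.abs_eq_natAbs] at h; exact_mod_cast h)

lemma natAbs_mul_mem_smoothNumbers {p : ℕ} {m n : ℤ} (hm : m.natAbs ∈ Nat.smoothNumbers p)
    (hn : n.natAbs ∈ Nat.smoothNumbers p) : (m * n).natAbs ∈ Nat.smoothNumbers p := by
  rw [Int.natAbs_mul]
  exact Nat.mul_mem_smoothNumbers hm hn

lemma exists_eq_pow_mul_and_not_dvd {p : ℕ} (hp : p ≠ 1) {n : ℤ} (hn : n ≠ 0) :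
    ∃ (e : ℕ) (m : ℤ), n = p ^ e * m ∧ ¬(p : ℤ) ∣ m := by
  obtain ⟨m, h, hm⟩ := FiniteMultiplicity.exists_eq_pow_mul_and_not_dvd
    ((Int.finiteMultiplicity_iff (a := p)).2 ⟨by simpa using hp, hn⟩)
  exact ⟨_, m, h, hm⟩

section Residue

variable (p : ℕ)

/-- The class of `⟨p * n⟩` modulo the classes of forms that involve only primes smaller
than `p`. -/
noncomputable def residueClass (n : ℤ) : WittGroup ⧸ smoothClasses p :=
  QuotientAddGroup.mk (unary (p * n))

variable {p}

lemma mk_unary_eq_zero {n : ℤ} (hn : n = 0 ∨ n.natAbs ∈ Nat.smoothNumbers p) :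
    (QuotientAddGroup.mk (unary n) : WittGroup ⧸ smoothClasses p) = 0 := by
  rcases hn with rfl | hn
  · simp [unary_zero]
  · exact (QuotientAddGroup.eq_zero_iff _).2 (unary_mem_smoothClasses hn)

lemma residueClass_zero : residueClass p 0 = 0 := by
  simp [residueClass, unary_zero]

variable [Fact p.Prime]

/-- The basic reduction step: write `a * b = r + p * l`; then `l` involves only
primes smaller than `p`, and so does the discriminant term in `⟨x⟩ + ⟨y⟩ = ⟨x+y⟩ + ⟨xy(x+y)⟩`. -/
lemma residueClass_mul_mul {a b m : ℤ} (ha : a ≠ 0) (ha' : |a| < p) (hb : b ≠ 0) (hb' : |b| < p)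
    (hm : m.natAbs ∈ Nat.smoothNumbers p) :
    residueClass p (a * b * m) = residueClass p (a * b % p * m) := by
  have hpz : (0 : ℤ) < p := by exact_mod_cast (Fact.out : p.Prime).pos
  have hp0 : (p : ℚ) ≠ 0 := by exact_mod_cast (Fact.out : p.Prime).ne_zero
  have hm0 : (m : ℚ) ≠ 0 := by
    have := Nat.ne_zero_of_mem_smoothNumbers hm
    simpa using this
  set r := a * b % p with hr
  set l := a * b / p with hl
  have hrl : r + p * l = a * b := Int.emod_add_mul_ediv _ _
  have hr0 : 0 ≤ r := Int.emod_nonneg _ hpz.ne'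
  have hrp : r < p := Int.emod_lt_of_pos _ hpz
  have hlp : |l| < p := by
    have h1 : |a * b| ≤ (p - 1) * (p - 1) := by
      rw [abs_mul]
      exact mul_le_mul (by omega) (by omega) (abs_nonneg _) (by omega)
    rw [abs_le] at h1
    rw [abs_lt]
    constructor <;> nlinarith
  have hl' : l = 0 ∨ l.natAbs ∈ Nat.smoothNumbers p :=
    (eq_or_ne l 0).imp_right fun h => natAbs_mem_smoothNumbers_of_lt h hlp
  have hr' : r = 0 ∨ r.natAbs ∈ Nat.smoothNumbers p :=
    (eq_or_ne r 0).imp_right fun h =>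
      natAbs_mem_smoothNumbers_of_lt h (by rwa [abs_of_nonneg hr0])
  have h1 := unary_add (p * (r * m : ℤ)) (p * (p * (l * m) : ℤ))
  have e1 : (p * (p * (l * m) : ℤ) : ℚ) = (l * m : ℤ) * (p : ℚ) ^ 2 := by push_cast; ring
  have e2 : (p * (r * m : ℤ) + p * (p * (l * m) : ℤ) : ℚ) = p * (a * b * m : ℤ) := by
    rw [← hrl]; push_cast; ring
  have e3 : (p * (r * m : ℤ) * (p * (p * (l * m) : ℤ)) * (p * (a * b * m : ℤ)) : ℚ) =
      (r * l * (a * b * m) : ℤ) * ((p : ℚ) ^ 2 * m) ^ 2 := by push_cast; ring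
  rw [e2, e3, e1, unary_mul_sq _ hp0, unary_mul_sq _ (mul_ne_zero (pow_ne_zero 2 hp0) hm0)] at h1
  have h2 := congrArg (QuotientAddGroup.mk : WittGroup → WittGroup ⧸ smoothClasses p) h1
  rw [QuotientAddGroup.mk_add, QuotientAddGroup.mk_add, mk_unary_eq_zero (n := l * m),
    mk_unary_eq_zero (n := r * l * (a * b * m)), add_zero, add_zero] at h2
  · exact h2.symm
  · rcases hr' with h | hr'
    · simp [h]
    rcases hl' with h | hl'
    · simp [h]
    exact .inr <| natAbs_mul_mem_smoothNumbers (natAbs_mul_mem_smoothNumbers hr' hl') <|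
      natAbs_mul_mem_smoothNumbers (natAbs_mul_mem_smoothNumbers
        (natAbs_mem_smoothNumbers_of_lt ha ha') (natAbs_mem_smoothNumbers_of_lt hb hb')) hm
  · rcases hl' with h | hl'
    · simp [h]
    exact .inr <| natAbs_mul_mem_smoothNumbers hl' hm

lemma residueClass_mul_natCast {n : ℕ} (hn : n ∈ Nat.smoothNumbers p) {m : ℤ} (hm : m ≠ 0)
    (hm' : |m| < p) : residueClass p (m * n) = residueClass p (m * n % p) := by
  have hp : p.Prime := Fact.out
  induction n using induction_on_primes generalizing m with
  | zero => exact absurd rfl (Nat.ne_zero_of_mem_smoothNumbers hn)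
  | one =>
    have := residueClass_mul_mul (m := 1) hm hm' one_ne_zero
      (by simpa using hp.one_lt) (by simp [Nat.mem_smoothNumbers])
    simpa using this
  | prime_mul q n hq ih =>
    have hqp : q < p := Nat.mem_smoothNumbers'.1 hn q hq (dvd_mul_right q n)
    have hnp : n ∈ Nat.smoothNumbers p := Nat.mem_smoothNumbers_of_dvd hn (dvd_mul_left n q)
    have h1 := residueClass_mul_mul (m := n) hm hm' (b := q) (by exact_mod_cast hq.ne_zero)
      (by simpa using hqp) (by simpa using hnp)
    have hmod : m * q % p ≠ 0 := by
      intro h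
      rcases (Nat.prime_iff_prime_int.1 hp).dvd_or_dvd (Int.dvd_of_emod_eq_zero h) with h | h
      · have := Int.le_of_dvd (abs_pos.2 hm) ((dvd_abs _ _).2 h)
        omega
      · exact absurd (Nat.le_of_dvd hq.pos (Int.natCast_dvd_natCast.1 h)) (by omega)
    have hpz : (0 : ℤ) < p := by exact_mod_cast hp.pos
    have h2 := ih hnp hmod (by
      rw [abs_of_nonneg (Int.emod_nonneg _ hpz.ne')]
      exact Int.emod_lt_of_pos _ hpz)
    push_cast
    rw [← mul_assoc, h1, h2]
    simp [Int.mul_emod]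

/-- Modulo the classes involving only smaller primes, `⟨p * n⟩` depends only on `n` modulo `p`, if
`n` itself involves only smaller primes. -/
lemma residueClass_eq_emod {n : ℤ} (hn : n.natAbs ∈ Nat.smoothNumbers p) :
    residueClass p n = residueClass p (n % p) := by
  have hp : p.Prime := Fact.out
  have hn0 : n ≠ 0 := by simpa using Nat.ne_zero_of_mem_smoothNumbers hn
  have h := residueClass_mul_natCast hn (m := n.sign) (by simpa using hn0)
    (by simpa [Int.abs_sign_of_ne_zero hn0] using hp.one_lt)
  rwa [Int.sign_mul_natAbs] at h

/-- `residueClass` as a function of the residue modulo `p`. -/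
noncomputable def residue (p : ℕ) (u : ZMod p) : WittGroup ⧸ smoothClasses p :=
  residueClass p (u.cast : ℤ)

lemma residueClass_eq_residue {n : ℤ} (hn : n.natAbs ∈ Nat.smoothNumbers p) :
    residueClass p n = residue p n := by
  rw [residueClass_eq_emod hn, residue, ZMod.coe_intCast]

lemma residue_zero : residue p 0 = 0 := by
  simp [residue, residueClass_zero]

lemma cast_natAbs_mem_smoothNumbers {u : ZMod p} (hu : u ≠ 0) :
    (u.cast : ℤ).natAbs ∈ Nat.smoothNumbers p := by
  have : NeZero p := ⟨(Fact.out : p.Prime).ne_zero⟩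
  rw [ZMod.cast_eq_val, Int.natAbs_natCast]
  exact Nat.mem_smoothNumbers_of_lt (Nat.pos_of_ne_zero ((ZMod.val_ne_zero u).2 hu))
    (ZMod.val_lt u)

lemma residue_mul_sq (u : ZMod p) {s : ZMod p} (hs : s ≠ 0) :
    residue p (u * s ^ 2) = residue p u := by
  rcases eq_or_ne u 0 with rfl | hu
  · simp
  have h1 := cast_natAbs_mem_smoothNumbers hu
  have h2 := cast_natAbs_mem_smoothNumbers hs
  have h3 := residueClass_eq_residue (p := p) (natAbs_mul_mem_smoothNumbers h1
    (natAbs_mul_mem_smoothNumbers h2 h2))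
  have hs0 : ((s.cast : ℤ) : ℚ) ≠ 0 := by
    have := Nat.ne_zero_of_mem_smoothNumbers h2
    exact Int.cast_ne_zero.2 (by simpa using this)
  push_cast [ZMod.intCast_zmod_cast] at h3
  rw [sq, ← h3, residue, residueClass, residueClass, ← unary_mul_sq (p * (u.cast : ℤ)) hs0]
  congr 2
  push_cast
  ring

lemma residue_neg (u : ZMod p) : residue p (-u) = -residue p u := by
  rcases eq_or_ne u 0 with rfl | hu
  · simp [residue_zero]
  have h1 := cast_natAbs_mem_smoothNumbers hu
  have h3 := residueClass_eq_residue (p := p) (n := -(u.cast : ℤ)) (by rwa [Int.natAbs_neg])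
  push_cast [ZMod.intCast_zmod_cast] at h3
  rw [← h3, residue, residueClass, residueClass, ← QuotientAddGroup.mk_neg, ← unary_neg]
  congr 2
  push_cast
  ring

lemma residue_add (u v : ZMod p) :
    residue p u + residue p v = residue p (u + v) + residue p (u * v * (u + v)) := by
  have : NeZero p := ⟨(Fact.out : p.Prime).ne_zero⟩
  rcases eq_or_ne u 0 with rfl | hu
  · simp [residue_zero]
  rcases eq_or_ne v 0 with rfl | hv
  · simp [residue_zero]
  rcases eq_or_ne (u + v) 0 with huv | huv
  · obtain rfl : v = -u := by linear_combination huv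
    simp [residue_zero, residue_neg]
  have hp0 : (p : ℚ) ≠ 0 := by exact_mod_cast (Fact.out : p.Prime).ne_zero
  -- With representatives of opposite signs, the sum has absolute value less than `p`, too.
  obtain ⟨a, ha, ha0, hap⟩ : ∃ a : ℤ, (a : ZMod p) = u ∧ 0 < a ∧ a < p :=
    ⟨u.val, by simp, by exact_mod_cast Nat.pos_of_ne_zero ((ZMod.val_ne_zero u).2 hu),
      by exact_mod_cast ZMod.val_lt u⟩
  obtain ⟨b, hb, hb0, hbp⟩ : ∃ b : ℤ, (b : ZMod p) = v ∧ -p < b ∧ b < 0 := by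
    have h1 : 0 < v.val := Nat.pos_of_ne_zero ((ZMod.val_ne_zero v).2 hv)
    have h2 := ZMod.val_lt v
    exact ⟨v.val - p, by simp, by omega, by omega⟩
  have hab : a + b ≠ 0 := by
    intro h
    apply huv
    rw [← ha, ← hb, ← Int.cast_add, h, Int.cast_zero]
  have sa : a.natAbs ∈ Nat.smoothNumbers p :=
    natAbs_mem_smoothNumbers_of_lt (by omega) (by rw [abs_lt]; constructor <;> omega)
  have sb : b.natAbs ∈ Nat.smoothNumbers p :=
    natAbs_mem_smoothNumbers_of_lt (by omega) (by rw [abs_lt]; constructor <;> omega)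
  have sab : (a + b).natAbs ∈ Nat.smoothNumbers p :=
    natAbs_mem_smoothNumbers_of_lt hab (by rw [abs_lt]; constructor <;> omega)
  have h1 := residueClass_eq_residue sa
  have h2 := residueClass_eq_residue sb
  have h3 := residueClass_eq_residue sab
  have h4 := residueClass_eq_residue
    (natAbs_mul_mem_smoothNumbers (natAbs_mul_mem_smoothNumbers sa sb) sab)
  push_cast [ha, hb] at h1 h2 h3 h4
  rw [← h1, ← h2, ← h3, ← h4]
  simp only [residueClass]
  rw [← QuotientAddGroup.mk_add, ← QuotientAddGroup.mk_add, unary_add,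
    ← unary_mul_sq (p * (a * b * (a + b) : ℤ)) hp0]
  congr 3
  · push_cast; ring
  · push_cast; ring

/-- Since binary forms over a finite field of odd order are universal, a sum of three residue
classes is a sum of two. -/
lemma exists_residue_add_residue (hp2 : p ≠ 2) (u v w : ZMod p) :
    ∃ u' v' : ZMod p, residue p u + residue p v + residue p w = residue p u' + residue p v' := by
  have hp : p.Prime := Fact.out
  rcases eq_or_ne u 0 with rfl | hu
  · exact ⟨v, w, by simp [residue_zero]⟩
  rcases eq_or_ne v 0 with rfl | hv
  · exact ⟨u, w, by simp [residue_zero]⟩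
  rcases eq_or_ne w 0 with rfl | hw
  · exact ⟨u, v, by simp [residue_zero]⟩
  obtain ⟨x, y, hxy⟩ : ∃ x y : ZMod p, u * x ^ 2 + (v * y ^ 2 + w) = 0 := by
    have h := FiniteField.exists_root_sum_quadratic (R := ZMod p)
      (f := Polynomial.C u * Polynomial.X ^ 2 + Polynomial.C 0 * Polynomial.X + Polynomial.C 0)
      (g := Polynomial.C v * Polynomial.X ^ 2 + Polynomial.C 0 * Polynomial.X + Polynomial.C w)
      (Polynomial.degree_quadratic hu) (Polynomial.degree_quadratic hv)
      (by rw [ZMod.card]; exact Nat.odd_iff.1 (hp.odd_of_ne_two hp2))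
    simpa using h
  rcases eq_or_ne x 0 with rfl | hx
  · refine ⟨u, 0, ?_⟩
    have hy : y ≠ 0 := by
      rintro rfl
      exact hw (by simpa using hxy)
    rw [show w = -(v * y ^ 2) by linear_combination hxy, residue_neg, residue_mul_sq _ hy,
      residue_zero]
    abel
  rcases eq_or_ne y 0 with rfl | hy
  · refine ⟨v, 0, ?_⟩
    rw [show w = -(u * x ^ 2) by linear_combination hxy, residue_neg, residue_mul_sq _ hx,
      residue_zero]
    abel
  refine ⟨u * x ^ 2 * (v * y ^ 2) * (u * x ^ 2 + v * y ^ 2), 0, ?_⟩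
  rw [← residue_mul_sq u hx, ← residue_mul_sq v hy, residue_add,
    show w = -(u * x ^ 2 + v * y ^ 2) by linear_combination hxy, residue_neg, residue_zero]
  abel

/-- In a diagonalization with largest prime `p`, the entries divisible by `p` can be reduced to at
most two (`residue p 0 = 0`), modulo forms that involve only smaller primes. -/
lemma exists_mk_eq_residue_add_residue (hp2 : p ≠ 2) {X : WittGroup}
    (hX : X ∈ smoothClasses (p + 1)) :
    ∃ u v : ZMod p, (QuotientAddGroup.mk X : WittGroup ⧸ smoothClasses p) =
      residue p u + residue p v := by
  have hp : p.Prime := Fact.out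
  induction hX using AddSubgroup.closure_induction with
  | mem w hw =>
    obtain ⟨n, hn, rfl⟩ := hw
    have hn0 : n ≠ 0 := by simpa using Nat.ne_zero_of_mem_smoothNumbers hn
    obtain ⟨e, m, rfl, hm⟩ := exists_eq_pow_mul_and_not_dvd hp.ne_one hn0
    have hms : m.natAbs ∈ Nat.smoothNumbers p := by
      rw [Nat.mem_smoothNumbers']
      intro q hq hqm
      have h1 := Nat.mem_smoothNumbers'.1 hn q hq
        (by rw [Int.natAbs_mul]; exact hqm.mul_left _)
      refine lt_of_le_of_ne (by omega) ?_
      rintro rfl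
      exact hm (Int.natCast_dvd.2 hqm)
    have hp0 : (p : ℚ) ≠ 0 := by exact_mod_cast hp.ne_zero
    rcases Nat.even_or_odd' e with ⟨k, rfl | rfl⟩
    · refine ⟨0, 0, ?_⟩
      rw [residue_zero, add_zero, show ((p ^ (2 * k) * m : ℤ) : ℚ) = m * ((p : ℚ) ^ k) ^ 2 by
        push_cast; ring, unary_mul_sq _ (pow_ne_zero _ hp0), mk_unary_eq_zero (.inr hms)]
    · refine ⟨m, 0, ?_⟩
      rw [residue_zero, add_zero, show ((p ^ (2 * k + 1) * m : ℤ) : ℚ) =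
        (p * m) * ((p : ℚ) ^ k) ^ 2 by push_cast; ring, unary_mul_sq _ (pow_ne_zero _ hp0),
        ← residueClass_eq_residue hms, residueClass]
  | zero => exact ⟨0, 0, by simp [residue_zero]⟩
  | add x y _ _ hx hy =>
    obtain ⟨u, v, h⟩ := hx
    obtain ⟨u', v', h'⟩ := hy
    obtain ⟨a, b, hab⟩ := exists_residue_add_residue hp2 u v u'
    obtain ⟨c, d, hcd⟩ := exists_residue_add_residue hp2 a b v'
    exact ⟨c, d, by rw [QuotientAddGroup.mk_add, h, h', ← hcd, ← hab]; abel⟩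
  | neg x _ hx =>
    obtain ⟨u, v, h⟩ := hx
    exact ⟨-u, -v, by rw [QuotientAddGroup.mk_neg, h, residue_neg, residue_neg]; abel⟩

lemma smoothClasses_le_integralClasses : smoothClasses p ≤ integralClasses (primeTo p) := by
  refine (AddSubgroup.closure_le _).2 ?_
  rintro _ ⟨n, hn, rfl⟩
  refine unary_mem_integralClasses (by simpa using Nat.ne_zero_of_mem_smoothNumbers hn) ?_
  exact (Nat.Prime.smoothNumbers_coprime Fact.out hn).symm

/-- One step of the descent: if a class is represented by an integer matrix that is invertible
modulo the odd prime `p`, then `p` can be removed from a diagonalization in which it is the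
largest prime. -/
lemma mem_smoothClasses_of_succ (hp2 : p ≠ 2) {X : WittGroup}
    (hX : X ∈ smoothClasses (p + 1)) (hX' : X ∈ integralClasses (primeTo p)) :
    X ∈ smoothClasses p := by
  have hp : p.Prime := Fact.out
  have : NeZero p := ⟨hp.ne_zero⟩
  obtain ⟨u, v, h⟩ := exists_mk_eq_residue_add_residue hp2 hX
  rw [← QuotientAddGroup.eq_zero_iff, h]
  have hmem : unary (p * (u.cast : ℤ)) + unary (p * (v.cast : ℤ)) ∈
      integralClasses (primeTo p) := by
    have h1 : X - (unary (p * (u.cast : ℤ)) + unary (p * (v.cast : ℤ))) ∈ smoothClasses p := by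
      rw [← QuotientAddGroup.eq_zero_iff, QuotientAddGroup.mk_sub, h, sub_eq_zero]
      rfl
    have h2 := sub_mem hX' (smoothClasses_le_integralClasses h1)
    rwa [sub_sub_cancel] at h2
  have hcast {u : ZMod p} (hu : u ≠ 0) : (u.cast : ℤ) ≠ 0 := by
    have := Nat.ne_zero_of_mem_smoothNumbers (cast_natAbs_mem_smoothNumbers hu)
    simpa using this
  -- A single residue class cannot occur, since a nonzero unary form has no zero modulo `p`.
  have hone {u : ZMod p} (hu : u ≠ 0)
      (h : unary (p * (u.cast : ℤ)) ∈ integralClasses (primeTo p)) : False := by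
    obtain ⟨x, ⟨k, hk⟩, hx⟩ := exists_isotropic_mod_of_mem (κ := Unit) (u := fun _ => u.cast)
      (fun _ => hcast hu) (by simpa using h)
    rw [← ZMod.intCast_zmod_eq_zero_iff_dvd] at hx
    simp [hu] at hx
    exact hk hx
  rcases eq_or_ne u 0 with rfl | hu
  · rcases eq_or_ne v 0 with rfl | hv
    · simp [residue_zero]
    · exact (hone hv (by simpa [unary_zero] using hmem)).elim
  rcases eq_or_ne v 0 with rfl | hv
  · exact (hone hu (by simpa [unary_zero] using hmem)).elim
  -- Two residue classes cancel, since the binary residue form `diag(u, v)` has a zero modulo `p`.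
  obtain ⟨x, ⟨k, hk⟩, hx⟩ := exists_isotropic_mod_of_mem (κ := Fin 2) (u := ![u.cast, v.cast])
    (by simp [Fin.forall_fin_two, hcast hu, hcast hv]) (by simpa using hmem)
  rw [← ZMod.intCast_zmod_eq_zero_iff_dvd] at hx
  simp only [Fin.sum_univ_two, cons_val_zero, cons_val_one] at hx
  push_cast [ZMod.intCast_zmod_cast] at hx
  have hx0 : (x 0 : ZMod p) ≠ 0 := by
    intro h0
    have h1 : (x 1 : ZMod p) = 0 := by simpa [h0, hv] using hx
    fin_cases k
    · exact hk h0
    · exact hk h1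
  have hx1 : (x 1 : ZMod p) ≠ 0 := by
    intro h1
    exact hx0 (by simpa [h1, hu] using hx)
  rw [← residue_mul_sq u hx0, ← residue_mul_sq v hx1,
    show (u * (x 0 : ZMod p) ^ 2) = -(v * (x 1 : ZMod p) ^ 2) by linear_combination hx,
    residue_neg, neg_add_cancel]

end Residue

lemma smoothClasses_mono {m n : ℕ} (h : m ≤ n) : smoothClasses m ≤ smoothClasses n := by
  refine AddSubgroup.closure_mono ?_
  rintro _ ⟨k, hk, rfl⟩
  exact ⟨k, Nat.smoothNumbers_mono h hk, rfl⟩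

lemma exists_mem_smoothClasses (X : WittGroup) : ∃ n, X ∈ smoothClasses n := by
  have hX : X ∈ (⊤ : AddSubgroup WittGroup) := trivial
  rw [← closure_unary_eq_top] at hX
  induction hX using AddSubgroup.closure_induction with
  | mem w hw =>
    obtain ⟨n, rfl⟩ := hw
    rcases eq_or_ne n 0 with rfl | hn
    · exact ⟨0, by simp [unary_zero, zero_mem]⟩
    · exact ⟨n.natAbs + 1, unary_mem_smoothClasses
        (Nat.mem_smoothNumbers_of_lt (Int.natAbs_pos.2 hn) (Nat.lt_succ_self _))⟩
  | zero => exact ⟨0, zero_mem _⟩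
  | add x y _ _ hx hy =>
    obtain ⟨m, hm⟩ := hx
    obtain ⟨n, hn⟩ := hy
    exact ⟨max m n, add_mem (smoothClasses_mono (le_max_left m n) hm)
      (smoothClasses_mono (le_max_right m n) hn)⟩
  | neg x _ hx => exact hx.imp fun n hn => neg_mem hn

/-- A class that is represented at every odd prime `p` by an integer matrix invertible modulo `p` is
a combination of `⟨1⟩` and `⟨2⟩`. -/
theorem exists_eq_zsmul_add_zsmul {X : WittGroup}
    (hX : ∀ p : ℕ, p.Prime → p ≠ 2 → X ∈ integralClasses (primeTo p)) :
    ∃ c d : ℤ, X = c • unary 1 + d • unary 2 := by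
  obtain ⟨n, hn⟩ := exists_mem_smoothClasses X
  have h3 : X ∈ smoothClasses 3 := by
    have hstep : ∀ n, 3 ≤ n → X ∈ smoothClasses n → X ∈ smoothClasses 3 := by
      intro n hn
      induction n, hn using Nat.le_induction with
      | base => exact id
      | succ n hn ih =>
        intro h
        apply ih
        by_cases hp : n.Prime
        · have : Fact n.Prime := ⟨hp⟩
          exact mem_smoothClasses_of_succ (by omega) h (hX n hp (by omega))
        · rwa [smoothClasses, Nat.smoothNumbers_succ hp] at h
    exact hstep (max n 3) (le_max_right _ _) (smoothClasses_mono (le_max_left _ _) hn)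
  clear hX hn
  induction h3 using AddSubgroup.closure_induction with
  | mem w hw =>
    obtain ⟨n, hn, rfl⟩ := hw
    have hn0 : n ≠ 0 := by simpa using Nat.ne_zero_of_mem_smoothNumbers hn
    obtain ⟨e, m, rfl, hm⟩ := exists_eq_pow_mul_and_not_dvd (p := 2) (by norm_num) hn0
    have hm1 : m.natAbs = 1 := by
      by_contra h1
      obtain ⟨q, hq, hqm⟩ := Nat.exists_prime_and_dvd h1
      have h2 := Nat.mem_smoothNumbers'.1 hn q hq (by rw [Int.natAbs_mul]; exact hqm.mul_left _)
      obtain rfl : q = 2 := by have := hq.two_le; omega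
      exact hm (Int.natCast_dvd.2 hqm)
    obtain ⟨k, rfl | rfl⟩ := Nat.even_or_odd' e
    · refine ⟨m, 0, ?_⟩
      rw [show (((2 : ℕ) ^ (2 * k) * m : ℤ) : ℚ) = m * ((2 : ℚ) ^ k) ^ 2 by push_cast; ring,
        unary_mul_sq _ (by positivity)]
      rcases Int.natAbs_eq m with h | h <;> rw [h, hm1] <;> simp [unary_neg]
    · refine ⟨0, m, ?_⟩
      rw [show (((2 : ℕ) ^ (2 * k + 1) * m : ℤ) : ℚ) = (m * 2) * ((2 : ℚ) ^ k) ^ 2 by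
        push_cast; ring, unary_mul_sq _ (by positivity)]
      rcases Int.natAbs_eq m with h | h <;> rw [h, hm1] <;> simp [unary_neg]
  | zero => exact ⟨0, 0, by simp⟩
  | add x y _ _ hx hy =>
    obtain ⟨c, d, rfl⟩ := hx
    obtain ⟨c', d', rfl⟩ := hy
    exact ⟨c + c', d + d', by rw [add_smul, add_smul]; abel⟩
  | neg x _ hx =>
    obtain ⟨c, d, rfl⟩ := hx
    exact ⟨-c, -d, by rw [neg_smul, neg_smul]; abel⟩

/-! ### Determinant, signature and metabolic forms -/

section Determinant

variable {ι : Type} [Fintype ι] [DecidableEq ι]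

/-- A metabolic form has a Gram matrix `[[0, B], [Bᵀ, D]]` with square blocks, whose determinant is
`± (det B) ^ 2`. -/
lemma isSquare_abs_det_of_metabolic {A : Matrix ι ι ℚ} (hA : A.IsSymm)
    (h : Metabolic (toBilin' A)) : IsSquare |A.det| := by
  obtain ⟨N, hN, hd⟩ := h
  obtain ⟨M, hM⟩ := Submodule.exists_isCompl N
  have hrank : finrank ℚ M = finrank ℚ N := by
    have := Submodule.finrank_add_eq_of_isCompl hM
    omega
  let b : Basis (Fin (finrank ℚ N) ⊕ Fin (finrank ℚ N)) ℚ (ι → ℚ) :=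
    ((finBasis ℚ N).prod ((finBasis ℚ M).reindex (finCongr hrank))).map
      (Submodule.prodEquivOfIsCompl N M hM)
  have hb : ∀ i, b (Sum.inl i) ∈ N := fun i => by simp [b]
  have hcard : Fintype.card ι = Fintype.card (Fin (finrank ℚ N) ⊕ Fin (finrank ℚ N)) := by
    rw [finrank_fintype_fun_eq_card] at hd
    simp [hd, two_mul]
  let e := Fintype.equivOfCardEq hcard
  let c := (Pi.basisFun ℚ ι).reindex e
  have hc : LinearMap.BilinForm.toMatrix c (toBilin' A) = A.submatrix e.symm e.symm := by
    ext i j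
    simp [LinearMap.BilinForm.toMatrix_apply, c]
  set T := LinearMap.BilinForm.toMatrix b (toBilin' A) with hT
  have hsymm : ∀ i j, T i j = T j i := fun i j => by
    rw [hT, LinearMap.BilinForm.toMatrix_apply, LinearMap.BilinForm.toMatrix_apply,
      (toBilin'_isSymm hA).eq]
  have hblocks : T = fromBlocks 0 T.toBlocks₁₂ T.toBlocks₁₂ᵀ T.toBlocks₂₂ := by
    ext (i | i) (j | j)
    · exact (LinearMap.BilinForm.toMatrix_apply _ _ _ _).trans (hN _ (hb i) _ (hb j))
    · rfl
    · exact hsymm _ _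
    · rfl
  have hdet : |T.det| = T.toBlocks₁₂.det * T.toBlocks₁₂.det := by
    have h1 := det_permute' (Equiv.sumComm (Fin (finrank ℚ N)) (Fin (finrank ℚ N))) T
    have h2 : T.submatrix id (Equiv.sumComm (Fin (finrank ℚ N)) (Fin (finrank ℚ N))) =
        fromBlocks T.toBlocks₁₂ 0 T.toBlocks₂₂ T.toBlocks₁₂ᵀ := by
      conv_lhs => rw [hblocks]
      ext (i | i) (j | j) <;> rfl
    rw [h2, det_fromBlocks_zero₁₂, det_transpose] at h1
    have h3 := congrArg abs h1
    rw [abs_mul_self, abs_mul] at h3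
    rw [h3]
    rcases Int.units_eq_one_or (Equiv.Perm.sign
      (Equiv.sumComm (Fin (finrank ℚ N)) (Fin (finrank ℚ N)))) with h | h <;> simp [h]
  have hchange : (b.toMatrix c).det * (b.toMatrix c).det * T.det = A.det := by
    have h1 := LinearMap.BilinForm.toMatrix_mul_basis_toMatrix (b := b) c (toBilin' A)
    have h2 := congrArg Matrix.det h1
    rw [hc, det_mul, det_mul, det_transpose, det_submatrix_equiv_self] at h2
    linarith
  rw [← hchange, abs_mul, abs_mul_self, hdet]
  exact ⟨(b.toMatrix c).det * T.toBlocks₁₂.det, by ring⟩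

/-- Otherwise `G ⊥ (2)` would be metabolic for some `G` with `|det G|` a square, so that `2` would
be a square. -/
lemma unary_two_notMem : unary 2 ∉ integralClasses (Submonoid.square ℕ) := by
  intro h
  obtain ⟨ι, _, _, G, hG, hd, hS, hw⟩ := neg_mem h
  have hdQ := det_map_intCast_ne_zero hd
  have hs : (fromBlocks (G.map (Int.cast : ℤ → ℚ)) 0 0
      (diagonal fun _ : Unit => (2 : ℚ))).IsSymm := by
    simp [Matrix.IsSymm, fromBlocks_transpose, (hG.map (Int.cast : ℤ → ℚ)).eq]
  have h0 : Metabolic (toBilin' (fromBlocks (G.map (Int.cast : ℤ → ℚ)) 0 0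
      (diagonal fun _ : Unit => (2 : ℚ)))) := by
    rw [← matCls_eq_zero_iff hs (by simpa using hdQ),
      matCls_fromBlocks (hG.map _) hdQ (isSymm_diagonal _) (by simp), hw, ← unary, neg_add_cancel]
  have h1 := isSquare_abs_det_of_metabolic hs h0
  rw [det_fromBlocks_zero₁₂, det_map_intCast, abs_mul, ← Int.cast_abs, Int.abs_eq_natAbs] at h1
  obtain ⟨s, hs⟩ := Submonoid.mem_square.1 hS
  have hs0 : s ≠ 0 := by
    rintro rfl
    simp [hd] at hs
  obtain ⟨r, hr⟩ := h1
  rw [hs] at hr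
  have h2 : IsSquare (2 : ℚ) := by
    refine ⟨r / s, ?_⟩
    have : (s : ℚ) ≠ 0 := by exact_mod_cast hs0
    field_simp
    simp at hr
    linarith
  have h3 : IsSquare (2 : ℕ) := by
    exact_mod_cast (Rat.isSquare_natCast_iff (n := 2)).1 (by exact_mod_cast h2)
  exact Nat.prime_two.prime.not_isSquare h3

end Determinant

section Signature

open QuadraticMap

variable {ι κ : Type*} [Fintype ι] [DecidableEq ι] [Fintype κ] [DecidableEq κ]
variable {𝕜 : Type*} [Field 𝕜]

lemma toQuadraticForm'_apply (A : Matrix ι ι 𝕜) (x : ι → 𝕜) :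
    A.toQuadraticForm' x = x ⬝ᵥ A *ᵥ x := by
  simp [Matrix.toQuadraticForm', Matrix.toLinearMap₂'_apply']

lemma toQuadraticForm'_neg (A : Matrix ι ι 𝕜) :
    (-A).toQuadraticForm' = -A.toQuadraticForm' := by
  ext x
  simp [toQuadraticForm'_apply, neg_mulVec]

variable [LinearOrder 𝕜]

lemma sigNeg_eq_sigPos_neg (A : Matrix ι ι 𝕜) :
    sigNeg A.toQuadraticForm' = sigPos (-A).toQuadraticForm' := by
  rw [toQuadraticForm'_neg, sigPos_neg]

lemma sigPos_congruence (A : Matrix κ κ 𝕜) {P : Matrix κ ι 𝕜} {Q : Matrix ι κ 𝕜}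
    (hPQ : P * Q = 1) (hQP : Q * P = 1) :
    sigPos (Pᵀ * A * P).toQuadraticForm' = sigPos A.toQuadraticForm' := by
  refine Equivalent.sigPos_eq ⟨⟨LinearEquiv.ofLinearMap P.mulVecLin Q.mulVecLin ?_ ?_, fun x => ?_⟩⟩
  · rw [← Matrix.mulVecLin_mul, hPQ, Matrix.mulVecLin_one]
  · rw [← Matrix.mulVecLin_mul, hQP, Matrix.mulVecLin_one]
  · change A.toQuadraticForm' (P *ᵥ x) = _
    rw [toQuadraticForm'_apply, toQuadraticForm'_apply, ← Matrix.mulVec_mulVec,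
      ← Matrix.mulVec_mulVec, Matrix.dotProduct_mulVec x Pᵀ, Matrix.vecMul_transpose]

lemma sigPos_diagonal [IsStrictOrderedRing 𝕜] (d : ι → 𝕜) :
    sigPos (diagonal d).toQuadraticForm' = {i | 0 < d i}.ncard := by
  rw [← QuadraticForm.sigPos_weightedSumSquares]
  congr 1
  ext x
  rw [toQuadraticForm'_apply, weightedSumSquares_apply]
  simp only [dotProduct, mulVec_diagonal, smul_eq_mul]
  exact Finset.sum_congr rfl fun i _ => by ring

lemma exists_diagonalization {A : Matrix ι ι ℚ} (hA : A.IsSymm) :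
    ∃ (P Q : Matrix ι ι ℚ) (d : ι → ℚ), P * Q = 1 ∧ Q * P = 1 ∧ Pᵀ * A * P = diagonal d := by
  obtain ⟨v, hv⟩ := LinearMap.BilinForm.exists_orthogonal_basis
    (LinearMap.BilinForm.isSymm_iff.1 (toBilin'_isSymm hA))
  let e : Fin (finrank ℚ (ι → ℚ)) ≃ ι := Fintype.equivOfCardEq (by simp)
  let w := v.reindex e
  let c := Pi.basisFun ℚ ι
  refine ⟨c.toMatrix w, w.toMatrix c, fun i => toBilin' A (w i) (w i),
    Basis.toMatrix_mul_toMatrix_flip _ _, Basis.toMatrix_mul_toMatrix_flip _ _, ?_⟩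
  have h1 := LinearMap.BilinForm.toMatrix_mul_basis_toMatrix (b := c) w (toBilin' A)
  have h2 : LinearMap.BilinForm.toMatrix c (toBilin' A) = A := by
    ext i j
    simp [LinearMap.BilinForm.toMatrix_apply, c]
  rw [h2] at h1
  rw [h1]
  ext i j
  rw [LinearMap.BilinForm.toMatrix_apply, diagonal_apply]
  split_ifs with h
  · rw [h]
  · simp only [w, Basis.reindex_apply]
    exact hv fun h' => h (e.symm.injective h')

/-- The index of inertia of a rational symmetric matrix can be computed over `ℚ`. -/
lemma sigPos_map_real {A : Matrix ι ι ℚ} (hA : A.IsSymm) :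
    sigPos (A.map (Rat.cast : ℚ → ℝ)).toQuadraticForm' = sigPos A.toQuadraticForm' := by
  obtain ⟨P, Q, d, hPQ, hQP, h⟩ := exists_diagonalization hA
  have hmap (X Y : Matrix ι ι ℚ) :
      (X * Y).map (Rat.cast : ℚ → ℝ) = X.map Rat.cast * Y.map Rat.cast :=
    Matrix.map_mul (f := Rat.castHom ℝ)
  have hone : (1 : Matrix ι ι ℚ).map (Rat.cast : ℚ → ℝ) = 1 :=
    Matrix.map_one _ Rat.cast_zero Rat.cast_one
  rw [← sigPos_congruence A hPQ hQP, h, sigPos_diagonal,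
    ← sigPos_congruence (A.map (Rat.cast : ℚ → ℝ)) (P := P.map Rat.cast) (Q := Q.map Rat.cast)
      (by rw [← hmap, hPQ, hone]) (by rw [← hmap, hQP, hone]), ← transpose_map, ← hmap, ← hmap, h,
    diagonal_map Rat.cast_zero, sigPos_diagonal]
  simp

lemma sigPos_fromBlocks {A : Matrix ι ι ℚ} {B : Matrix κ κ ℚ} (hA : A.IsSymm) (hB : B.IsSymm) :
    sigPos (fromBlocks A 0 0 B).toQuadraticForm' =
      sigPos A.toQuadraticForm' + sigPos B.toQuadraticForm' := by
  obtain ⟨P, Q, d, hPQ, hQP, h⟩ := exists_diagonalization hA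
  obtain ⟨P', Q', d', hPQ', hQP', h'⟩ := exists_diagonalization hB
  rw [← sigPos_congruence A hPQ hQP, ← sigPos_congruence B hPQ' hQP', h, h',
    ← sigPos_congruence (fromBlocks A 0 0 B) (P := fromBlocks P 0 0 P') (Q := fromBlocks Q 0 0 Q')
      (by simp [fromBlocks_multiply, hPQ, hPQ']) (by simp [fromBlocks_multiply, hQP, hQP'])]
  simp only [fromBlocks_transpose, fromBlocks_multiply, transpose_zero, Matrix.zero_mul,
    Matrix.mul_zero, add_zero, zero_add, h, h', fromBlocks_diagonal]
  rw [sigPos_diagonal, sigPos_diagonal, sigPos_diagonal]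
  have : {i | 0 < Sum.elim d d' i} = Sum.inl '' {i | 0 < d i} ∪ Sum.inr '' {i | 0 < d' i} := by
    ext (i | i) <;> simp
  rw [this, Set.ncard_union_eq, Set.ncard_image_of_injective _ Sum.inl_injective,
    Set.ncard_image_of_injective _ Sum.inr_injective]
  rw [Set.disjoint_left]
  rintro _ ⟨i, _, rfl⟩ ⟨j, _, h⟩
  cases h

lemma sigPos_le_of_metabolic {A : Matrix ι ι ℚ} (h : Metabolic (toBilin' A)) :
    2 * sigPos A.toQuadraticForm' ≤ Fintype.card ι := by
  obtain ⟨N, hN, hd⟩ := h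
  have h1 := QuadraticForm.sigPos_add_finrank_le_of_nonpos (Q := A.toQuadraticForm') (V := N)
    fun x hx => by
      rw [toQuadraticForm'_apply, ← Matrix.toBilin'_apply', hN x hx x hx]
  rw [finrank_fintype_fun_eq_card] at h1 hd
  omega

lemma sigPos_add_sigNeg {A : Matrix ι ι ℚ} (hA : A.IsSymm) (hd : A.det ≠ 0) :
    sigPos A.toQuadraticForm' + sigNeg A.toQuadraticForm' = Fintype.card ι := by
  obtain ⟨P, Q, d, hPQ, hQP, h⟩ := exists_diagonalization hA
  have hd0 : ∀ i, d i ≠ 0 := by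
    have h1 := congrArg Matrix.det hPQ
    rw [det_mul, det_one] at h1
    have h2 := congrArg Matrix.det h
    rw [det_mul, det_mul, det_transpose, det_diagonal] at h2
    have h3 : ∏ i, d i ≠ 0 := by
      rw [← h2]
      exact mul_ne_zero (mul_ne_zero (left_ne_zero_of_mul_eq_one h1) hd)
        (left_ne_zero_of_mul_eq_one h1)
    exact fun i => Finset.prod_ne_zero_iff.1 h3 i (Finset.mem_univ i)
  rw [sigNeg_eq_sigPos_neg, ← sigPos_congruence A hPQ hQP, ← sigPos_congruence (-A) hPQ hQP,
    Matrix.mul_neg, Matrix.neg_mul, h, diagonal_neg, sigPos_diagonal, sigPos_diagonal,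
    ← Nat.card_eq_fintype_card, ← Set.ncard_add_ncard_compl {i | 0 < d i}]
  congr 2
  ext i
  have := hd0 i
  simp only [Left.neg_pos_iff, Set.mem_ofPred_eq, Set.mem_compl_iff, not_lt]
  exact ⟨le_of_lt, fun h => lt_of_le_of_ne h this⟩

end Signature

/-- If a form of signature zero is Witt equivalent to a sum of `c` copies of `⟨1⟩`,
then `c = 0`. -/
lemma eq_zero_of_matCls_eq_nsmul {ι : Type} [Fintype ι] [DecidableEq ι] {A : Matrix ι ι ℚ}
    (hA : A.IsSymm) (hd : A.det ≠ 0)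
    (hsig : sigPos A.toQuadraticForm' = sigNeg A.toQuadraticForm') {c : ℕ}
    (h : matCls A = c • unary 1) : c = 0 := by
  have hdiag : matCls (diagonal fun _ : Fin c => (1 : ℚ)) = c • unary 1 := by
    rw [matCls_diagonal _ fun _ => one_ne_zero]
    simp
  have hd1 : (diagonal fun _ : Fin c => (1 : ℚ)).det ≠ 0 := by simp
  have hdA : (-A).det ≠ 0 := by simpa [det_neg] using hd
  have hs : (fromBlocks (-A) 0 0 (diagonal fun _ : Fin c => (1 : ℚ))).IsSymm := by
    simp [Matrix.IsSymm, fromBlocks_transpose, hA.eq]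
  have h0 : Metabolic (toBilin' (fromBlocks (-A) 0 0 (diagonal fun _ : Fin c => (1 : ℚ)))) := by
    rw [← matCls_eq_zero_iff hs (by rw [det_fromBlocks_zero₁₂]; exact mul_ne_zero hdA hd1),
      matCls_fromBlocks hA.neg hdA (isSymm_diagonal _) hd1, matCls_neg hA hd, h, hdiag,
      neg_add_cancel]
  have h1 := sigPos_le_of_metabolic h0
  rw [sigPos_fromBlocks hA.neg (isSymm_diagonal _), ← sigNeg_eq_sigPos_neg, sigPos_diagonal] at h1
  have h2 := sigPos_add_sigNeg hA hd
  simp [Set.ncard_univ] at h1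
  omega

/-- A symmetric integer matrix of signature zero whose determinant is, up to sign, a
square and a power of two, is metabolic over `ℚ`. -/
theorem metabolic_of_sig_eq_zero {ι : Type} [Fintype ι] [DecidableEq ι] {G : Matrix ι ι ℤ}
    (hG : G.IsSymm) (hd : G.det ≠ 0) (hp : ∀ p : ℕ, p.Prime → p ≠ 2 → G.det.natAbs.Coprime p)
    (hsq : IsSquare G.det.natAbs)
    (hsig : sigPos (G.map (Int.cast : ℤ → ℚ)).toQuadraticForm' =
      sigNeg (G.map (Int.cast : ℤ → ℚ)).toQuadraticForm') :
    Metabolic (toBilin' (G.map (Int.cast : ℤ → ℚ))) := by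
  have hs := hG.map (Int.cast : ℤ → ℚ)
  have hdQ := det_map_intCast_ne_zero hd
  set A := G.map (Int.cast : ℤ → ℚ) with hA
  obtain ⟨c, d, hcd⟩ := exists_eq_zsmul_add_zsmul (X := matCls A) fun p hpp hp2 =>
    ⟨ι, inferInstance, inferInstance, G, hG, hd, hp p hpp hp2, rfl⟩
  have h2 : unary 2 + unary 2 = unary 1 + unary 1 := by
    have h := unary_add 2 2
    have e1 := unary_mul_sq 1 (s := 2) (by norm_num)
    have e2 := unary_mul_sq 1 (s := 4) (by norm_num)
    norm_num at h e1 e2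
    rw [h, e1, e2]
  have hone : unary 1 ∈ integralClasses (Submonoid.square ℕ) := by
    simpa using unary_mem_integralClasses (n := 1) one_ne_zero
      (Submonoid.mem_square.2 (by simp : IsSquare (Int.natAbs 1)))
  have hAmem : matCls A ∈ integralClasses (Submonoid.square ℕ) :=
    ⟨ι, inferInstance, inferInstance, G, hG, hd, Submonoid.mem_square.2 hsq, rfl⟩
  obtain ⟨k, rfl | rfl⟩ := Int.even_or_odd' d
  · have h3 : matCls A = (c + 2 * k) • unary 1 := by
      rw [hcd, mul_comm 2 k, mul_smul, two_smul, h2, ← two_smul ℤ, ← mul_smul, ← add_smul]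
    have h4 : c + 2 * k = 0 := by
      obtain ⟨n, hn | hn⟩ := Int.eq_nat_or_neg (c + 2 * k)
      · rw [hn, natCast_zsmul] at h3
        rw [hn, eq_zero_of_matCls_eq_nsmul hs hdQ hsig h3, Nat.cast_zero]
      · have h5 : matCls (-A) = n • unary 1 := by
          rw [matCls_neg hs hdQ, h3, hn, neg_smul, neg_neg, natCast_zsmul]
        rw [hn, eq_zero_of_matCls_eq_nsmul hs.neg (by simpa [det_neg] using hdQ) ?_ h5,
          Nat.cast_zero, neg_zero]
        rw [toQuadraticForm'_neg, sigPos_neg, sigNeg_neg, hsig]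
    rw [← matCls_eq_zero_iff hs hdQ, h3, h4, zero_smul]
  · exfalso
    apply unary_two_notMem
    have h3 : matCls A - (c + 2 * k) • unary 1 = unary 2 := by
      rw [hcd, add_smul (2 * k) 1, mul_comm 2 k, mul_smul, two_smul, h2, ← two_smul ℤ, ← mul_smul,
        add_smul, one_smul]
      abel
    rw [← h3]
    exact sub_mem hAmem (zsmul_mem hone _)

/-! ### Lattices that contain twice their dual -/

section TwoElementary

variable {n : ℕ}

lemma castVec_mulVec {m n : Type*} [Fintype n] (A : Matrix m n ℤ) (z : n → ℤ) :
    castVec m (A *ᵥ z) = A.map (Int.cast : ℤ → ℚ) *ᵥ castVec n z := by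
  ext i
  simp [mulVec, dotProduct]

lemma castVec_dotProduct {n : Type*} [Fintype n] (x y : n → ℤ) :
    castVec n x ⬝ᵥ castVec n y = ((x ⬝ᵥ y : ℤ) : ℚ) := by
  simp [dotProduct]

lemma mulVec_dotProduct_eq {R m n : Type*} [Fintype m] [Fintype n] [CommRing R] (A : Matrix m n R)
    (x : n → R) (y : m → R) : (A *ᵥ x) ⬝ᵥ y = x ⬝ᵥ Aᵀ *ᵥ y := by
  rw [dotProduct_mulVec, vecMul_transpose]

/-- Let `P` be a lattice in `ℚ ^ n`, integral for the form `A`, that contains twice its dual.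
Then the Gram matrix `G` of a basis of `P` divides `2`. -/
lemma exists_gram_of_lattice {A : Matrix (Fin n) (Fin n) ℚ} (hd : A.det ≠ 0)
    (P : Submodule ℤ (Fin n → ℚ)) (hZ : ∀ z, castVec (Fin n) z ∈ P)
    (hint : ∀ x ∈ P, ∀ y ∈ P, ∃ m : ℤ, x ⬝ᵥ A *ᵥ y = m)
    (hdual : ∀ y, (∀ x ∈ P, ∃ m : ℤ, x ⬝ᵥ A *ᵥ y = m) → (2 : ℤ) • y ∈ P) :
    ∃ (B : Matrix (Fin n) (Fin n) ℚ) (G H : Matrix (Fin n) (Fin n) ℤ), B.det ≠ 0 ∧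
      Bᵀ * A * B = G.map (Int.cast : ℤ → ℚ) ∧ G * H = (2 : ℤ) • 1 ∧ ∀ j, B.col j ∈ P := by
  have hAint : ∀ x ∈ P, A *ᵥ x ∈ LinearMap.range (castVec (Fin n)) := by
    intro x hx
    have h1 : ∀ i, ∃ m : ℤ, (A *ᵥ x) i = m := fun i => by
      obtain ⟨m, hm⟩ := hint _ (hZ (Pi.single i 1)) x hx
      refine ⟨m, hm ▸ ?_⟩
      rw [castVec_single, single_one_dotProduct]
    choose z hz using h1
    exact ⟨z, funext fun i => (hz i).symm⟩
  have hfin : Module.Finite ℤ P := by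
    let f : P →ₗ[ℤ] LinearMap.range (castVec (Fin n)) :=
      ((A.mulVecLin.restrictScalars ℤ).domRestrict P).codRestrict _ fun x => hAint x x.2
    refine Module.Finite.of_injective f fun x y hxy => Subtype.ext ?_
    have h1 : A *ᵥ (x : Fin n → ℚ) = A *ᵥ (y : Fin n → ℚ) := congrArg Subtype.val hxy
    exact mulVec_injective_of_isUnit ((isUnit_iff_isUnit_det A).2 (isUnit_iff_ne_zero.2 hd)) h1
  have hfree : Module.Free ℤ P := inferInstance
  let b₀ := Module.finBasis ℤ P
  have hli₀ : LinearIndependent ℚ fun k => (b₀ k : Fin n → ℚ) := by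
    rw [← LinearIndependent.iff_fractionRing ℤ ℚ]
    exact b₀.linearIndependent.map' P.subtype P.ker_subtype
  have hspan₀ : ∀ x ∈ P, x ∈ Submodule.span ℤ (Set.range fun k => (b₀ k : Fin n → ℚ)) := by
    intro x hx
    have h1 : (⟨x, hx⟩ : P) ∈ Submodule.span ℤ (Set.range b₀) := by simp [b₀.span_eq]
    have h2 := Submodule.mem_map_of_mem (f := P.subtype) h1
    rwa [Submodule.map_span, ← Set.range_comp] at h2
  have htop : Submodule.span ℚ (Set.range fun k => (b₀ k : Fin n → ℚ)) = ⊤ := by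
    rw [eq_top_iff]
    intro x _
    obtain ⟨d, hd, z, hz⟩ := exists_smul_eq_castVec x
    have h4 := Submodule.span_le_restrictScalars ℤ ℚ _ (hspan₀ _ (hZ z))
    rw [hz, ← Int.cast_smul_eq_zsmul ℚ] at h4
    exact (Submodule.smul_mem_iff _ (by exact_mod_cast hd)).1 h4
  have hrank : finrank ℤ P = n := by
    have h1 := finrank_span_eq_card hli₀
    rw [htop, finrank_top, finrank_fintype_fun_eq_card, Fintype.card_fin, Fintype.card_fin] at h1
    exact h1.symm
  let b := b₀.reindex (finCongr hrank)
  have hli : LinearIndependent ℚ fun k => (b k : Fin n → ℚ) := by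
    have := hli₀.comp _ (finCongr hrank).symm.injective
    simpa [b, Function.comp_def] using this
  have hcoord : ∀ x ∈ P, ∃ c : Fin n → ℤ, x = ∑ k, c k • (b k : Fin n → ℚ) := by
    intro x hx
    refine ⟨b.repr ⟨x, hx⟩, ?_⟩
    have := congrArg P.subtype (b.sum_repr ⟨x, hx⟩)
    rw [map_sum] at this
    exact this.symm
  let B : Matrix (Fin n) (Fin n) ℚ := (of fun k => (b k : Fin n → ℚ))ᵀ
  have hBcol : ∀ k, B.col k = b k := fun k => rfl
  have hB : B.det ≠ 0 := by
    have h1 : LinearIndependent ℚ B.col := hli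
    rw [linearIndependent_cols_iff_isUnit, isUnit_iff_isUnit_det] at h1
    exact h1.ne_zero
  have hBmul : ∀ c : Fin n → ℤ, B *ᵥ castVec _ c = ∑ k, c k • (b k : Fin n → ℚ) := by
    intro c
    ext i
    simp [B, mulVec, dotProduct, Finset.sum_apply, mul_comm]
  choose G hG using fun i j => hint (b i) (b i).2 (b j) (b j).2
  have hGram : Bᵀ * A * B = (of G).map (Int.cast : ℤ → ℚ) := by
    ext i j
    rw [map_apply, of_apply, ← hG, ← hBcol, ← hBcol, Matrix.mul_assoc, Matrix.mul_apply']
    rfl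
  have hGd : ((of G).map (Int.cast : ℤ → ℚ)).det ≠ 0 := by
    rw [← hGram, det_mul, det_mul, det_transpose]
    exact mul_ne_zero (mul_ne_zero hB hd) hB
  set G' := (of G).map (Int.cast : ℤ → ℚ) with hG'
  -- The columns of `B * G'⁻¹` are the basis of the dual lattice dual to `b`.
  have hdualmem : ∀ j, (2 : ℤ) • (B * G'⁻¹).col j ∈ P := by
    intro j
    refine hdual _ fun x hx => ?_
    obtain ⟨c, rfl⟩ := hcoord x hx
    refine ⟨c j, ?_⟩
    have h1 : A *ᵥ (B * G'⁻¹).col j = (A * (B * G'⁻¹)).col j := by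
      ext i
      simp [Matrix.mul_apply, mulVec, dotProduct, Matrix.col]
    have h2 : Bᵀ * (A * (B * G'⁻¹)) = 1 := by
      rw [← Matrix.mul_assoc, ← Matrix.mul_assoc, hGram,
        mul_nonsing_inv _ (isUnit_iff_ne_zero.2 hGd)]
    rw [← hBmul, h1, mulVec_dotProduct_eq]
    have h3 : Bᵀ *ᵥ (A * (B * G'⁻¹)).col j = (Bᵀ * (A * (B * G'⁻¹))).col j := by
      ext i
      simp [Matrix.mul_apply, mulVec, dotProduct, Matrix.col]
    rw [h3, h2]
    simp [dotProduct, Matrix.col, one_apply]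
  choose H hH using fun j => hcoord _ (hdualmem j)
  refine ⟨B, of G, (of H)ᵀ, hB, hGram, ?_, fun j => by rw [hBcol]; exact (b j).2⟩
  have h1 : B * (of H)ᵀ.map (Int.cast : ℤ → ℚ) = (2 : ℤ) • (B * G'⁻¹) := by
    ext i j
    have h2 := congrFun (hH j) i
    rw [← hBmul] at h2
    exact h2.symm
  have h2 : Function.Injective fun M : Matrix (Fin n) (Fin n) ℤ => M.map (Int.cast : ℤ → ℚ) :=
    map_injective Int.cast_injective
  apply h2
  have h3 : (of H)ᵀ.map (Int.cast : ℤ → ℚ) = (2 : ℤ) • G'⁻¹ := by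
    have h4 := congrArg (B⁻¹ * ·) h1
    simp only [Matrix.mul_smul] at h4
    rwa [nonsing_inv_mul_cancel_left _ _ (isUnit_iff_ne_zero.2 hB),
      nonsing_inv_mul_cancel_left _ _ (isUnit_iff_ne_zero.2 hB)] at h4
  have h5 : (of G * (of H)ᵀ).map (Int.cast : ℤ → ℚ) = G' * (of H)ᵀ.map Int.cast :=
    Matrix.map_mul (f := Int.castRingHom ℚ)
  change (of G * (of H)ᵀ).map (Int.cast : ℤ → ℚ) = _
  rw [h5, h3, Matrix.mul_smul, mul_nonsing_inv _ (isUnit_iff_ne_zero.2 hGd)]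
  ext i j
  simp only [Matrix.smul_apply, map_apply, one_apply]
  split_ifs <;> simp

lemma coprime_det_of_mul_eq_two {G H : Matrix (Fin n) (Fin n) ℤ} (h : G * H = (2 : ℤ) • 1) {p : ℕ}
    (hp : p.Prime) (hp2 : p ≠ 2) : G.det.natAbs.Coprime p := by
  have h1 := congrArg (fun M : Matrix _ _ ℤ => M.det.natAbs) h
  simp only [det_mul, det_smul, det_one, mul_one, Fintype.card_fin, Int.natAbs_mul,
    Int.natAbs_pow] at h1
  have h2 : (2 ^ n).Coprime p :=
    Nat.Coprime.pow_left _ ((Nat.coprime_primes Nat.prime_two hp).2 hp2.symm)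
  exact Nat.Coprime.coprime_dvd_left ⟨_, h1.symm⟩ h2

/-- A symmetric matrix over `ZMod 2` with zero diagonal lifts to a skew-symmetric integer matrix;
in odd size its determinant vanishes. -/
lemma even_of_alternating {m : ℕ} {S : Matrix (Fin m) (Fin m) (ZMod 2)} (hS : S.IsSymm)
    (hdiag : ∀ i, S i i = 0) (hd : S.det ≠ 0) : Even m := by
  by_contra hm
  rw [Nat.not_even_iff_odd] at hm
  let A : Matrix (Fin m) (Fin m) ℤ := of fun i j =>
    if i < j then (S i j).cast else if j < i then -(S i j).cast else 0
  have hA : Aᵀ = -A := by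
    ext i j
    simp only [A, transpose_apply, neg_apply, of_apply, hS.apply i j]
    rcases lt_trichotomy i j with h | h | h
    · simp [h, h.not_gt]
    · simp [h]
    · simp [h, h.not_gt]
  have hmap : A.map (Int.cast : ℤ → ZMod 2) = S := by
    ext i j
    simp only [A, map_apply, of_apply]
    rcases lt_trichotomy i j with h | h | h
    · simp [h]
    · simp [h, hdiag]
    · simp [h, h.not_gt, ZMod.neg_eq_self_mod_two]
  have h1 := congrArg Matrix.det hA
  rw [det_transpose, det_neg, Fintype.card_fin, hm.neg_one_pow] at h1
  have h2 : A.det = 0 := by linarith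
  rw [← hmap, det_map_intCast, h2] at hd
  simp at hd

lemma even_dotProduct_mulVec {G : Matrix (Fin n) (Fin n) ℤ} (hG : G.IsSymm)
    (heven : ∀ i, Even (G i i)) (x : Fin n → ℤ) : Even (x ⬝ᵥ G *ᵥ x) := by
  choose d hd using heven
  -- `G = U + Uᵀ` for the upper triangular half `U` of `G`.
  let U : Matrix (Fin n) (Fin n) ℤ := of fun i j =>
    if i < j then G i j else if i = j then d i else 0
  have hU : G = U + Uᵀ := by
    ext i j
    simp only [U, Matrix.add_apply, transpose_apply, of_apply]
    rcases lt_trichotomy i j with h | h | h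
    · simp [h, h.not_gt, h.ne']
    · simp [h, hd]
    · simp [h, h.not_gt, h.ne', hG.apply i j]
  refine ⟨x ⬝ᵥ U *ᵥ x, ?_⟩
  nth_rw 1 [hU]
  rw [add_mulVec, dotProduct_add, ← mulVec_dotProduct_eq, dotProduct_comm (U *ᵥ x)]

/-- Modulo `2` an even symmetric matrix defines an alternating form, and so its rank is even. -/
lemma even_rank_mod_two {G : Matrix (Fin n) (Fin n) ℤ} (hG : G.IsSymm) (heven : ∀ i, Even (G i i)) :
    Even (finrank (ZMod 2) (LinearMap.range (G.map (Int.cast : ℤ → ZMod 2)).mulVecLin)) := by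
  let F := ZMod 2
  set S := G.map (Int.cast : ℤ → F) with hS
  have hSs : S.IsSymm := hG.map _
  let C : BilinForm F (Fin n → F) := toBilin' S
  have hC : ∀ x y, C x y = x ⬝ᵥ S *ᵥ y := fun x y => Matrix.toBilin'_apply' _ _ _
  have hCs : C.IsSymm := toBilin'_isSymm hSs
  have hCalt : ∀ x, C x x = 0 := by
    intro x
    choose g hg using fun k => ZMod.intCast_surjective (x k)
    obtain rfl : (fun k => (g k : F)) = x := funext hg
    obtain ⟨m, hm⟩ := even_dotProduct_mulVec hG heven g
    have h1 := congrArg (Int.cast : ℤ → ZMod 2) hm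
    rw [← two_mul, Int.cast_mul, show ((2 : ℤ) : ZMod 2) = 0 from rfl, zero_mul] at h1
    rw [← h1, hC]
    simp only [dotProduct, mulVec]
    push_cast
    rfl
  have hker : LinearMap.ker C = LinearMap.ker S.mulVecLin := by
    ext x
    rw [LinearMap.mem_ker, LinearMap.mem_ker, mulVecLin_apply, LinearMap.ext_iff,
      ← dotProduct_eq_zero_iff]
    exact forall_congr' fun y => by rw [hCs.eq, hC, dotProduct_comm]; rfl
  obtain ⟨W, hW⟩ := Submodule.exists_isCompl (LinearMap.ker C)
  have hnd : (C.restrict W).Nondegenerate :=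
    LinearMap.IsSymm.nondegenerate_restrict_of_isCompl_ker
      (LinearMap.BilinForm.isSymm_iff.1 hCs) hW.symm
  let w := finBasis F W
  have hW2 : Even (finrank F W) := by
    refine even_of_alternating (S := LinearMap.BilinForm.toMatrix w (C.restrict W)) ?_ ?_
      ((LinearMap.BilinForm.nondegenerate_iff_det_ne_zero w).1 hnd)
    · ext i j
      simp only [transpose_apply, LinearMap.BilinForm.toMatrix_apply]
      exact hCs.eq _ _
    · intro i
      rw [LinearMap.BilinForm.toMatrix_apply]
      exact hCalt _
  have h1 := Submodule.finrank_add_eq_of_isCompl hW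
  have h2 := LinearMap.finrank_range_add_finrank_ker S.mulVecLin
  rw [← hker, ← h1, add_comm, Nat.add_left_cancel_iff] at h2
  rwa [h2]

/-- An even symmetric integer matrix of even size that divides `2` has the determinant
`± 2 ^ a` with `a` even: `a` is the corank of the matrix modulo `2`. -/
lemma isSquare_det_of_even {G H : Matrix (Fin n) (Fin n) ℤ} (hG : G.IsSymm)
    (heven : ∀ i, Even (G i i)) (h : G * H = (2 : ℤ) • 1) (hn : Even n) :
    IsSquare G.det.natAbs := by
  have hd : G.det ≠ 0 := by
    intro h0
    have h1 := congrArg Matrix.det h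
    rw [det_mul, h0, zero_mul, det_smul, det_one, mul_one] at h1
    exact absurd h1.symm (by positivity)
  let F := ZMod 2
  let Gb := (G.map (Int.cast : ℤ → F)).mulVecLin
  let R := LinearMap.range Gb
  have hcard : G.det.natAbs = 2 ^ finrank F ((Fin n → F) ⧸ R) := by
    have hinj : Function.Injective G.mulVecLin := mulVec_injective_of_det_ne_zero hd
    have h1 := Submodule.natAbs_det_equiv (LinearMap.range G.mulVecLin)
      (LinearEquiv.ofInjective _ hinj)
    have h2 : LinearMap.det ((LinearMap.range G.mulVecLin).subtype ∘ₗ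
        AddMonoidHom.toIntLinearMap (LinearEquiv.ofInjective _ hinj : (Fin n → ℤ) →+ _)) =
          G.det := by
      rw [← LinearMap.det_toLin' G]
      congr 1
    rw [h2] at h1
    rw [h1]
    -- Since `2 ℤ ^ n = G H ℤ ^ n` lies in the image of `G`, the cokernel of `G` is that of `G`
    -- modulo `2`.
    let red : (Fin n → ℤ) →+ (Fin n → F) := (Int.castAddHom F).compLeft (Fin n)
    let f : (Fin n → ℤ) →+ ((Fin n → F) ⧸ R) := R.mkQ.toAddMonoidHom.comp red
    have hf : Function.Surjective f := by
      refine (Submodule.mkQ_surjective R).comp fun x => ?_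
      choose g hg using fun k => ZMod.intCast_surjective (x k)
      exact ⟨g, funext hg⟩
    have hker : f.ker = (LinearMap.range G.mulVecLin).toAddSubgroup := by
      have hred (w : Fin n → ℤ) : red (G *ᵥ w) = Gb (red w) := by
        ext i
        change ((∑ j, G i j * w j : ℤ) : ZMod 2) = ∑ j, (G i j : ZMod 2) * (w j : ZMod 2)
        push_cast
        rfl
      ext z
      rw [AddMonoidHom.mem_ker, Submodule.mem_toAddSubgroup]
      change R.mkQ (red z) = 0 ↔ _
      rw [Submodule.mkQ_apply, Submodule.Quotient.mk_eq_zero]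
      constructor
      · rintro ⟨w, hw⟩
        choose g hg using fun k => ZMod.intCast_surjective (w k)
        have hgw : red g = w := funext hg
        have h3 : ∀ i, (2 : ℤ) ∣ (z - G *ᵥ g) i := by
          intro i
          have h4 : red (z - G *ᵥ g) = 0 := by rw [map_sub, hred, hgw, hw, sub_self]
          exact (ZMod.intCast_zmod_eq_zero_iff_dvd _ 2).1 (congrFun h4 i)
        choose t ht using h3
        refine ⟨g + H *ᵥ t, ?_⟩
        have h5 : z - G *ᵥ g = (2 : ℤ) • t := funext ht
        rw [mulVecLin_apply, mulVec_add, mulVec_mulVec, h, smul_mulVec, one_mulVec, ← h5]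
        abel
      · rintro ⟨w, rfl⟩
        exact ⟨red w, (hred w).symm⟩
    have h3 : (LinearMap.range G.mulVecLin).toAddSubgroup.index = Nat.card ((Fin n → F) ⧸ R) := by
      rw [← hker, AddSubgroup.index_ker, AddMonoidHom.range_eq_top.2 hf]
      exact Nat.card_congr (Equiv.Set.univ _)
    have h4 := Module.natCard_eq_pow_finrank (K := F) (V := (Fin n → F) ⧸ R)
    rw [Nat.card_zmod] at h4
    rw [← h4, ← h3]
    rfl
  rw [hcard]
  have h1 := R.finrank_quotient_add_finrank
  rw [finrank_fintype_fun_eq_card, Fintype.card_fin] at h1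
  have h2 : Even (finrank F R) := even_rank_mod_two hG heven
  refine Even.isSquare_pow ?_ 2
  rw [← h1, Nat.even_add] at hn
  exact hn.2 h2

end TwoElementary

/-! ### The overlattice of a Lagrangian subgroup and its eigenlattices -/

lemma map_intCast_mul {R l m n : Type*} [CommRing R] [Fintype m] (A : Matrix l m ℤ)
    (B : Matrix m n ℤ) :
    (A * B).map (Int.cast : ℤ → R) = A.map (Int.cast : ℤ → R) * B.map (Int.cast : ℤ → R) :=
  Matrix.map_mul (f := Int.castRingHom R)

section Overlattice

variable {N : ℕ} (T : EdgeTheory N) (L : Set (Fin N → ℤ))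

/-- The Gram matrix of the theory over `ℚ`. -/
abbrev KQ : Matrix (Fin N) (Fin N) ℚ := T.K.map (Int.cast : ℤ → ℚ)

lemma KQ_symm : (KQ T)ᵀ = KQ T := by
  rw [KQ, ← transpose_map, T.K_symm]

lemma KQ_det : IsUnit (KQ T).det :=
  isUnit_iff_ne_zero.2 (det_map_intCast_ne_zero T.K_nondegenerate)

lemma K_dotProduct (x y : Fin N → ℚ) : (KQ T *ᵥ x) ⬝ᵥ y = x ⬝ᵥ KQ T *ᵥ y := by
  rw [mulVec_dotProduct_eq, KQ_symm]

/-- The overlattice `K⁻¹ L` of `ℤ ^ N` defined by a Lagrangian subgroup `L`. Maximality of `L`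
allows to describe it as the set of vectors `x` such that `K x` is integral and pairs integrally
with `K⁻¹ L`; in this form it is a subgroup by definition. -/
def overlattice : Submodule ℤ (Fin N → ℚ) where
  carrier := {x | (∃ z : Fin N → ℤ, KQ T *ᵥ x = castVec _ z) ∧
    ∀ l ∈ L, ∃ m : ℤ, castVec _ l ⬝ᵥ x = m}
  add_mem' := by
    rintro x y ⟨⟨z, hz⟩, hx⟩ ⟨⟨w, hw⟩, hy⟩
    refine ⟨⟨z + w, by rw [mulVec_add, hz, hw, map_add]⟩, fun l hl => ?_⟩
    obtain ⟨m, hm⟩ := hx l hl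
    obtain ⟨m', hm'⟩ := hy l hl
    exact ⟨m + m', by rw [dotProduct_add, hm, hm', Int.cast_add]⟩
  zero_mem' := ⟨⟨0, by simp⟩, fun l _ => ⟨0, by simp⟩⟩
  smul_mem' := by
    rintro c x ⟨⟨z, hz⟩, hx⟩
    refine ⟨⟨c • z, by rw [mulVec_smul, hz, map_smul]⟩, fun l hl => ?_⟩
    obtain ⟨m, hm⟩ := hx l hl
    exact ⟨c * m, by rw [dotProduct_smul, hm]; simp⟩

variable {T L}

lemma castVec_mem_overlattice (z : Fin N → ℤ) : castVec _ z ∈ overlattice T L :=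
  ⟨⟨T.K *ᵥ z, (castVec_mulVec _ _).symm⟩, fun l _ => ⟨l ⬝ᵥ z, castVec_dotProduct _ _⟩⟩

lemma pairing_eq (l : Fin N → ℤ) {z : Fin N → ℤ} {x : Fin N → ℚ} (hz : KQ T *ᵥ x = castVec _ z) :
    T.pairing l z = castVec _ l ⬝ᵥ x := by
  have h : (KQ T)⁻¹ *ᵥ castVec _ z = x := by
    rw [← hz, mulVec_mulVec, nonsing_inv_mul _ (KQ_det T), one_mulVec]
  rw [← h]
  rfl

lemma exists_mem_of_mem_overlattice (hL : T.IsLagrangian L) {x : Fin N → ℚ}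
    (hx : x ∈ overlattice T L) :
    ∃ l ∈ L, ∃ Λ : Fin N → ℤ, KQ T *ᵥ x = castVec _ l + KQ T *ᵥ castVec _ Λ := by
  obtain ⟨⟨z, hz⟩, hx⟩ := hx
  have h : ∃ l ∈ L, T.Equivalent z l := by
    by_contra hcon
    obtain ⟨l, hl, hn⟩ := hL.maximal z hcon
    obtain ⟨m, hm⟩ := hx l hl
    exact hn ⟨m, by rw [pairing_eq l hz, hm]⟩
  obtain ⟨l, hl, Λ, hΛ⟩ := h
  exact ⟨l, hl, Λ, by rw [hz, ← castVec_mulVec, ← map_add, ← hΛ, add_sub_cancel]⟩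

lemma overlattice_integral (hL : T.IsLagrangian L) {x y : Fin N → ℚ} (hx : x ∈ overlattice T L)
    (hy : y ∈ overlattice T L) : ∃ m : ℤ, x ⬝ᵥ KQ T *ᵥ y = m := by
  obtain ⟨l, hl, Λ, h⟩ := exists_mem_of_mem_overlattice hL hx
  obtain ⟨⟨w, hw⟩, hy⟩ := hy
  obtain ⟨m, hm⟩ := hy l hl
  refine ⟨m + Λ ⬝ᵥ w, ?_⟩
  rw [← K_dotProduct, h, add_dotProduct, hm, K_dotProduct, hw, castVec_dotProduct, Int.cast_add]

lemma overlattice_even (hL : T.IsLagrangian L) (hT : T.IsBosonic) {x : Fin N → ℚ}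
    (hx : x ∈ overlattice T L) : ∃ m : ℤ, Even m ∧ x ⬝ᵥ KQ T *ᵥ x = m := by
  obtain ⟨l, hl, Λ, h⟩ := exists_mem_of_mem_overlattice hL hx
  obtain ⟨m, hm, hlm⟩ := hL.bosons hT l hl
  have h1 : KQ T *ᵥ (x - castVec _ Λ) = castVec _ l := by rw [mulVec_sub, h, add_sub_cancel_right]
  rw [pairing_eq l h1] at hlm
  refine ⟨m + 2 * (l ⬝ᵥ Λ) + Λ ⬝ᵥ T.K *ᵥ Λ, ?_, ?_⟩
  · exact (hm.add (even_two_mul _)).add (even_dotProduct_mulVec T.K_symm hT Λ)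
  · push_cast
    rw [← hlm, ← castVec_dotProduct, ← castVec_dotProduct, castVec_mulVec, ← K_dotProduct, h,
      add_dotProduct, K_dotProduct, dotProduct_sub, h, dotProduct_add,
      dotProduct_comm (castVec _ Λ) (castVec _ l)]
    ring

lemma mem_overlattice_of_dual (hL : T.IsLagrangian L) {y : Fin N → ℚ}
    (hy : ∀ x ∈ overlattice T L, ∃ m : ℤ, x ⬝ᵥ KQ T *ᵥ y = m) : y ∈ overlattice T L := by
  constructor
  · have h1 : ∀ i, ∃ m : ℤ, (KQ T *ᵥ y) i = m := fun i => by
      obtain ⟨m, hm⟩ := hy _ (castVec_mem_overlattice (Pi.single i 1))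
      refine ⟨m, hm ▸ ?_⟩
      rw [castVec_single, single_one_dotProduct]
    choose z hz using h1
    exact ⟨z, funext hz⟩
  · intro l hl
    have h1 : KQ T *ᵥ ((KQ T)⁻¹ *ᵥ castVec _ l) = castVec _ l := by
      rw [mulVec_mulVec, mul_nonsing_inv _ (KQ_det T), one_mulVec]
    obtain ⟨m, hm⟩ := hy ((KQ T)⁻¹ *ᵥ castVec _ l) ⟨⟨l, h1⟩, fun l' hl' => by
      rw [← pairing_eq l' h1]
      exact hL.integral l' hl' l hl⟩
    exact ⟨m, by rw [← hm, ← K_dotProduct, h1]⟩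

/-- The action of the symmetry over `ℚ`. -/
abbrev WQ (T : EdgeTheory N) : Matrix (Fin N) (Fin N) ℚ := T.W.map (Int.cast : ℤ → ℚ)

lemma transpose_W_mul_K (T : EdgeTheory N) : T.Wᵀ * T.K = T.K * T.W := by
  have h := congrArg (· * T.W) T.W_preserves
  simpa [Matrix.mul_assoc, T.W_sq] using h

lemma K_mul_W (T : EdgeTheory N) : KQ T * WQ T = (WQ T)ᵀ * KQ T := by
  rw [← transpose_map, ← map_intCast_mul, ← map_intCast_mul, transpose_W_mul_K]

lemma W_mulVec_mem_overlattice (hI : T.IsInvariant L) {x : Fin N → ℚ}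
    (hx : x ∈ overlattice T L) : WQ T *ᵥ x ∈ overlattice T L := by
  obtain ⟨⟨z, hz⟩, hx⟩ := hx
  refine ⟨⟨T.Wᵀ *ᵥ z, ?_⟩, fun l hl => ?_⟩
  · rw [mulVec_mulVec, K_mul_W, ← mulVec_mulVec, hz, castVec_mulVec, transpose_map]
  · obtain ⟨l', hl', Λ, hΛ⟩ := hI l hl
    obtain ⟨m, hm⟩ := hx l' hl'
    refine ⟨m + Λ ⬝ᵥ z, ?_⟩
    have h1 : castVec _ l ⬝ᵥ WQ T *ᵥ x = castVec _ (T.Wᵀ *ᵥ l) ⬝ᵥ x := by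
      rw [castVec_mulVec, transpose_map, mulVec_dotProduct_eq, transpose_transpose]
    rw [h1, eq_add_of_sub_eq' hΛ, map_add, add_dotProduct, hm, castVec_mulVec, K_dotProduct, hz,
      castVec_dotProduct, Int.cast_add]

end Overlattice

section Eigenlattice

variable {N n : ℕ} {T : EdgeTheory N} {V : Matrix (Fin N) (Fin n) ℤ} {ε : ℤ}

lemma restrict_map (T : EdgeTheory N) (V : Matrix (Fin N) (Fin n) ℤ) :
    (T.restrict V).map (Int.cast : ℤ → ℚ) =
      (V.map (Int.cast : ℤ → ℚ))ᵀ * KQ T * V.map (Int.cast : ℤ → ℚ) := by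
  rw [EdgeTheory.restrict, map_intCast_mul, map_intCast_mul, transpose_map]

lemma restrict_isSymm (T : EdgeTheory N) (V : Matrix (Fin N) (Fin n) ℤ) :
    (T.restrict V).IsSymm := by
  simp [Matrix.IsSymm, EdgeTheory.restrict, Matrix.mul_assoc, T.K_symm]

lemma restrict_dotProduct (T : EdgeTheory N) (V : Matrix (Fin N) (Fin n) ℤ) (x y : Fin n → ℚ) :
    x ⬝ᵥ (T.restrict V).map (Int.cast : ℤ → ℚ) *ᵥ y =
      (V.map (Int.cast : ℤ → ℚ) *ᵥ x) ⬝ᵥ KQ T *ᵥ (V.map (Int.cast : ℤ → ℚ) *ᵥ y) := by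
  rw [restrict_map, mulVec_dotProduct_eq, mulVec_mulVec, mulVec_mulVec]

lemma mulVec_injective_rat (hV : Function.Injective V.mulVec) :
    Function.Injective (V.map (Int.cast : ℤ → ℚ)).mulVec := by
  have h : ∀ x, V.map (Int.cast : ℤ → ℚ) *ᵥ x = 0 → x = 0 := by
    intro x hx
    obtain ⟨d, hd, z, hz⟩ := exists_smul_eq_castVec x
    have h1 : castVec _ (V *ᵥ z) = 0 := by rw [castVec_mulVec, hz, mulVec_smul, hx, smul_zero]
    have h2 : V *ᵥ z = 0 := castVec_injective (by rw [h1, map_zero])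
    have h3 : z = 0 := hV (by rw [h2, mulVec_zero])
    rw [h3, map_zero] at hz
    exact (smul_eq_zero.1 hz.symm).resolve_left hd
  intro x y hxy
  exact sub_eq_zero.1 (h _ (by rw [mulVec_sub]; exact sub_eq_zero.2 hxy))

lemma W_mulVec_of_range (hr : Set.range V.mulVec = {Λ | T.W *ᵥ Λ = ε • Λ}) :
    T.W * V = ε • V := by
  refine Matrix.ext_of_mulVec_single fun i => ?_
  have h : V *ᵥ Pi.single i 1 ∈ {Λ | T.W *ᵥ Λ = ε • Λ} := hr ▸ ⟨_, rfl⟩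
  rw [← mulVec_mulVec, smul_mulVec]
  exact h

lemma exists_mulVec_eq_of_range (hr : Set.range V.mulVec = {Λ | T.W *ᵥ Λ = ε • Λ})
    {x : Fin N → ℚ} (hx : WQ T *ᵥ x = ε • x) : ∃ c, x = V.map (Int.cast : ℤ → ℚ) *ᵥ c := by
  obtain ⟨d, hd, z, hz⟩ := exists_smul_eq_castVec x
  have h1 : z ∈ {Λ | T.W *ᵥ Λ = ε • Λ} := by
    refine castVec_injective ?_
    rw [castVec_mulVec, map_smul, hz, mulVec_smul, hx, smul_comm]
  rw [← hr] at h1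
  obtain ⟨c, rfl⟩ := h1
  have hd' : (d : ℚ) ≠ 0 := by exact_mod_cast hd
  refine ⟨(d : ℚ)⁻¹ • castVec _ c, ?_⟩
  rw [mulVec_smul, ← castVec_mulVec, hz, ← Int.cast_smul_eq_zsmul ℚ, inv_smul_smul₀ hd']

/-- The component of `x` in the eigenspace of `ε = ± 1` is `(x + ε W x) / 2`, and the other
component is orthogonal to the eigenspace. -/
lemma two_smul_dotProduct (hε : ε * ε = 1)
    (hr : Set.range V.mulVec = {Λ | T.W *ᵥ Λ = ε • Λ}) (x : Fin N → ℚ) (c : Fin n → ℚ) :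
    ∃ a, x + ε • WQ T *ᵥ x = V.map (Int.cast : ℤ → ℚ) *ᵥ a ∧
      2 * (x ⬝ᵥ KQ T *ᵥ (V.map (Int.cast : ℤ → ℚ) *ᵥ c)) =
        a ⬝ᵥ (T.restrict V).map (Int.cast : ℤ → ℚ) *ᵥ c := by
  have hW2 : WQ T *ᵥ (WQ T *ᵥ x) = x := by
    rw [mulVec_mulVec, ← map_intCast_mul, T.W_sq, Matrix.map_one _ Int.cast_zero Int.cast_one,
      one_mulVec]
  obtain ⟨a, ha⟩ := exists_mulVec_eq_of_range hr (x := x + ε • WQ T *ᵥ x) (by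
    rw [mulVec_add, mulVec_smul, hW2, smul_add, smul_smul, hε, one_smul, add_comm])
  refine ⟨a, ha, ?_⟩
  have hWV : WQ T *ᵥ (V.map (Int.cast : ℤ → ℚ) *ᵥ c) = ε • (V.map (Int.cast : ℤ → ℚ) *ᵥ c) := by
    rw [mulVec_mulVec, ← map_intCast_mul, W_mulVec_of_range hr, ← smul_mulVec]
    congr 1
    ext i j
    simp
  rw [restrict_dotProduct, ← ha, add_dotProduct, smul_dotProduct, mulVec_dotProduct_eq,
    mulVec_mulVec _ (WQ T)ᵀ, ← K_mul_W, ← mulVec_mulVec, hWV, mulVec_smul, dotProduct_smul,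
    smul_smul, hε, one_smul, two_mul]

lemma restrict_det_ne_zero (hε : ε * ε = 1) (hV : Function.Injective V.mulVec)
    (hr : Set.range V.mulVec = {Λ | T.W *ᵥ Λ = ε • Λ}) : (T.restrict V).det ≠ 0 := by
  intro h0
  have h1 : ((T.restrict V).map (Int.cast : ℤ → ℚ)).det = 0 := by
    rw [det_map_intCast, h0, Int.cast_zero]
  obtain ⟨c, hc, hc0⟩ := exists_mulVec_eq_zero_iff.2 h1
  apply hc
  have h2 : KQ T *ᵥ (V.map (Int.cast : ℤ → ℚ) *ᵥ c) = 0 := by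
    rw [← dotProduct_eq_zero_iff]
    intro x
    obtain ⟨a, -, ha⟩ := two_smul_dotProduct hε hr x c
    rw [hc0, dotProduct_zero] at ha
    rw [dotProduct_comm]
    linarith
  have h3 : V.map (Int.cast : ℤ → ℚ) *ᵥ c = 0 :=
    mulVec_injective_of_isUnit ((isUnit_iff_isUnit_det _).2 (KQ_det T)) (by simpa using h2)
  exact mulVec_injective_rat hV (by simpa using h3)

/-- The intersection of the overlattice with an eigenspace, in the coordinates given by `V`. -/
def eigenlattice (T : EdgeTheory N) (L : Set (Fin N → ℤ)) (V : Matrix (Fin N) (Fin n) ℤ) :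
    Submodule ℤ (Fin n → ℚ) :=
  (overlattice T L).comap ((V.map (Int.cast : ℤ → ℚ)).mulVecLin.restrictScalars ℤ)

lemma mem_eigenlattice {L : Set (Fin N → ℤ)} {c : Fin n → ℚ} :
    c ∈ eigenlattice T L V ↔ V.map (Int.cast : ℤ → ℚ) *ᵥ c ∈ overlattice T L := Iff.rfl

/-- The eigenlattices of an involution of a unimodular lattice contain twice their duals. -/
lemma two_smul_mem_eigenlattice {L : Set (Fin N → ℤ)} (hL : T.IsLagrangian L)
    (hI : T.IsInvariant L) (hε : ε * ε = 1)
    (hr : Set.range V.mulVec = {Λ | T.W *ᵥ Λ = ε • Λ}) {y : Fin n → ℚ}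
    (hy : ∀ x ∈ eigenlattice T L V,
      ∃ m : ℤ, x ⬝ᵥ (T.restrict V).map (Int.cast : ℤ → ℚ) *ᵥ y = m) :
    (2 : ℤ) • y ∈ eigenlattice T L V := by
  rw [mem_eigenlattice]
  refine mem_overlattice_of_dual hL fun x hx => ?_
  obtain ⟨a, ha, ha'⟩ := two_smul_dotProduct hε hr x y
  obtain ⟨m, hm⟩ := hy a (by
    rw [mem_eigenlattice, ← ha]
    exact add_mem hx (Submodule.smul_mem _ _ (W_mulVec_mem_overlattice hI hx)))
  refine ⟨m, ?_⟩
  rw [mulVec_smul, mulVec_smul, dotProduct_smul, ← hm, ← ha']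
  simp

lemma hasCompleteNullVectors_of_metabolic {A : Matrix (Fin n) (Fin n) ℤ}
    (h : Metabolic (toBilin' (A.map (Int.cast : ℤ → ℚ)))) : HasCompleteNullVectors A := by
  obtain ⟨M, hM, hd⟩ := h
  rw [finrank_fintype_fun_eq_card, Fintype.card_fin] at hd
  obtain ⟨Λ, hli, hΛ, -⟩ := exists_integral_basis M
  refine ⟨finrank ℚ M, hd, Λ, hli, fun i j => ?_⟩
  have h := hM _ (hΛ i) _ (hΛ j)
  rw [Matrix.toBilin'_apply', ← castVec_mulVec, castVec_dotProduct] at h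
  exact_mod_cast h

/-- An eigenlattice of signature zero has a complete set of null vectors. -/
theorem hasCompleteNullVectors_restrict {L : Set (Fin N → ℤ)} (hL : T.IsLagrangian L)
    (hI : T.IsInvariant L) (hε : ε * ε = 1) (hV : Function.Injective V.mulVec)
    (hr : Set.range V.mulVec = {Λ | T.W *ᵥ Λ = ε • Λ})
    (hsig : sigPos ((T.restrict V).map (Int.cast : ℤ → ℚ)).toQuadraticForm' =
      sigNeg ((T.restrict V).map (Int.cast : ℤ → ℚ)).toQuadraticForm')
    (hferm : T.IsFermionic → IsSquare (T.restrict V).det.natAbs) :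
    HasCompleteNullVectors (T.restrict V) := by
  set A := (T.restrict V).map (Int.cast : ℤ → ℚ) with hA
  have hAd : A.det ≠ 0 := det_map_intCast_ne_zero (restrict_det_ne_zero hε hV hr)
  have hAs : A.IsSymm := (restrict_isSymm T V).map _
  obtain ⟨B, G, H, hB, hG, hGH, hcol⟩ := exists_gram_of_lattice hAd (eigenlattice T L V)
    (fun z => by
      rw [mem_eigenlattice, ← castVec_mulVec]
      exact castVec_mem_overlattice _)
    (fun x hx y hy => by
      rw [hA, restrict_dotProduct]
      exact overlattice_integral hL hx hy)
    (fun y hy => two_smul_mem_eigenlattice hL hI hε hr hy)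
  have hBinv : IsUnit B.det := isUnit_iff_ne_zero.2 hB
  have hGs : G.IsSymm := by
    have h1 : (G.map (Int.cast : ℤ → ℚ)).IsSymm := by
      rw [← hG]
      simp [Matrix.IsSymm, Matrix.mul_assoc, hAs.eq]
    exact map_injective (α := ℤ) Int.cast_injective h1
  have hdet : B.det * B.det * A.det = (G.det : ℚ) := by
    rw [← det_map_intCast, ← hG, det_mul, det_mul, det_transpose]
    ring
  have hGd : G.det ≠ 0 := by
    intro h0
    rw [h0, Int.cast_zero] at hdet
    exact mul_ne_zero (mul_ne_zero hB hB) hAd hdet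
  have hn : Even n := by
    have h1 := sigPos_add_sigNeg hAs hAd
    rw [← hsig, Fintype.card_fin] at h1
    exact ⟨_, h1.symm⟩
  have hsq : IsSquare G.det.natAbs := by
    by_cases hT : T.IsBosonic
    · refine isSquare_det_of_even hGs (fun j => ?_) hGH hn
      obtain ⟨m, hm, hmG⟩ := overlattice_even hL hT (mem_eigenlattice.1 (hcol j))
      rw [← restrict_dotProduct, ← hA] at hmG
      have h1 : ((G j j : ℤ) : ℚ) = m := by
        rw [← hmG]
        have h2 := congrFun (congrFun hG j) j
        rw [map_apply] at h2
        rw [← h2, Matrix.mul_assoc, Matrix.mul_apply']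
        rfl
      have h2 : G j j = m := by exact_mod_cast h1
      rwa [h2]
    · have hF : T.IsFermionic := by
        simp only [EdgeTheory.IsBosonic, not_forall, Int.not_even_iff_odd] at hT
        exact hT
      obtain ⟨r, hr⟩ := hferm hF
      have h1 : IsSquare ((G.det.natAbs : ℕ) : ℚ) := by
        -- `det G = (det B) ^ 2 * det A`, where `|det A| = r ^ 2`.
        refine ⟨B.det * r, ?_⟩
        have h2 := congrArg abs hdet
        rw [abs_mul, abs_mul_self, hA, det_map_intCast (T.restrict V), ← Int.cast_abs,
          ← Int.cast_abs, Int.abs_eq_natAbs, Int.abs_eq_natAbs, hr] at h2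
        rw [← Int.cast_natCast (R := ℚ) G.det.natAbs, ← h2]
        push_cast
        ring
      exact Rat.isSquare_natCast_iff.1 h1
  have hBB : B * B⁻¹ = 1 := mul_nonsing_inv _ hBinv
  have hBB' : B⁻¹ * B = 1 := nonsing_inv_mul _ hBinv
  have hGsig : sigPos (G.map (Int.cast : ℤ → ℚ)).toQuadraticForm' =
      sigNeg (G.map (Int.cast : ℤ → ℚ)).toQuadraticForm' := by
    rw [sigNeg_eq_sigPos_neg, ← hG, sigPos_congruence A hBB hBB', hsig, sigNeg_eq_sigPos_neg,
      ← sigPos_congruence (-A) hBB hBB']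
    simp
  have hmet := metabolic_of_sig_eq_zero hGs hGd
    (fun p hp hp2 => coprime_det_of_mul_eq_two hGH hp hp2) hsq hGsig
  refine hasCompleteNullVectors_of_metabolic (hmet.of_equiv
    (Matrix.toLinearEquiv' B (B.invertibleOfIsUnitDet hBinv)) fun x y hxy => ?_)
  change toBilin' A (B *ᵥ x) (B *ᵥ y) = 0
  rw [Matrix.toBilin'_apply', ← hG, ← mulVec_mulVec, ← mulVec_mulVec, ← mulVec_dotProduct_eq] at hxy
  rw [Matrix.toBilin'_apply', hxy]

end Eigenlattice

section Signature

lemma sig_eq {n : ℕ} {A : Matrix (Fin n) (Fin n) ℤ} (hA : A.IsSymm) :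
    sig A = sigPos (A.map (Int.cast : ℤ → ℚ)).toQuadraticForm' -
      sigPos (-A.map (Int.cast : ℤ → ℚ)).toQuadraticForm' := by
  have h1 : A.map (Int.cast : ℤ → ℝ) = (A.map (Int.cast : ℤ → ℚ)).map (Rat.cast : ℚ → ℝ) := by
    ext
    simp
  have h2 : -(A.map (Int.cast : ℤ → ℚ)).map (Rat.cast : ℚ → ℝ) =
      (-A.map (Int.cast : ℤ → ℚ)).map (Rat.cast : ℚ → ℝ) := by
    ext
    simp
  have hs := hA.map (Int.cast : ℤ → ℚ)
  rw [sig, h1, sigNeg_eq_sigPos_neg, h2, sigPos_map_real hs, sigPos_map_real hs.neg]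

lemma sigPos_two_smul {ι : Type*} [Fintype ι] [DecidableEq ι] {A : Matrix ι ι ℚ}
    (hA : A.IsSymm) :
    sigPos ((2 : ℚ) • A).toQuadraticForm' = sigPos A.toQuadraticForm' := by
  obtain ⟨P, Q, d, hPQ, hQP, h⟩ := exists_diagonalization hA
  rw [← sigPos_congruence A hPQ hQP, ← sigPos_congruence ((2 : ℚ) • A) hPQ hQP, Matrix.mul_smul,
    Matrix.smul_mul, h, ← diagonal_smul, sigPos_diagonal, sigPos_diagonal]
  simp

lemma exists_inverse_of_bijective {m n : Type*} [Fintype m] [DecidableEq m] [Fintype n]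
    [DecidableEq n] {U : Matrix m n ℚ} (hU : Function.Bijective U.mulVec) :
    ∃ Q : Matrix n m ℚ, U * Q = 1 ∧ Q * U = 1 := by
  let e := LinearEquiv.ofBijective U.mulVecLin hU
  refine ⟨LinearMap.toMatrix' e.symm.toLinearMap, ?_, ?_⟩
  · apply Matrix.toLin'.injective
    rw [Matrix.toLin'_mul, Matrix.toLin'_toMatrix', Matrix.toLin'_one]
    exact LinearMap.ext fun x => e.apply_symm_apply x
  · apply Matrix.toLin'.injective
    rw [Matrix.toLin'_mul, Matrix.toLin'_toMatrix', Matrix.toLin'_one]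
    exact LinearMap.ext fun x => e.symm_apply_apply x

variable {N nP nM : ℕ} {T : EdgeTheory N} {VP : Matrix (Fin N) (Fin nP) ℤ}
  {VM : Matrix (Fin N) (Fin nM) ℤ}

/-- In a basis adapted to the two eigenspaces, `K` is `diag(K₊, K₋)` and `K (1 - W)` is
`diag(0, 2 K₋)`. Hence the signatures of `K₊` and `K₋` vanish if those of `K` and `K (1 - W)` do. -/
lemma sig_restrict_eq_zero (hVP : Function.Injective VP.mulVec)
    (hrP : Set.range VP.mulVec = {Λ | T.W *ᵥ Λ = (1 : ℤ) • Λ})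
    (hVM : Function.Injective VM.mulVec)
    (hrM : Set.range VM.mulVec = {Λ | T.W *ᵥ Λ = (-1 : ℤ) • Λ})
    (hsig : sig (T.K * (1 - T.W)) = 0) (h_i : sig T.K = 0) :
    sig (T.restrict VP) = 0 ∧ sig (T.restrict VM) = 0 := by
  have hWP := W_mulVec_of_range hrP
  have hWM := W_mulVec_of_range hrM
  rw [one_smul] at hWP
  rw [neg_one_smul] at hWM
  set VP' := VP.map (Int.cast : ℤ → ℚ) with hVP'
  set VM' := VM.map (Int.cast : ℤ → ℚ) with hVM'
  have hWP' : WQ T * VP' = VP' := by rw [hVP', ← map_intCast_mul, hWP]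
  have hWM' : WQ T * VM' = -VM' := by
    rw [hVM', ← map_intCast_mul, hWM]
    ext
    simp
  have hcross : VP'ᵀ * KQ T * VM' = 0 := by
    have h1 : VP'ᵀ * KQ T * VM' = -(VP'ᵀ * KQ T * VM') := by
      conv_lhs => rw [← hWP', transpose_mul, Matrix.mul_assoc VP'ᵀ, ← K_mul_W, Matrix.mul_assoc,
        Matrix.mul_assoc, hWM']
      simp [Matrix.mul_assoc]
    ext i j
    have h2 := congrFun (congrFun h1 i) j
    rw [Matrix.neg_apply] at h2
    rw [Matrix.zero_apply]
    linarith
  have hcross' : VM'ᵀ * KQ T * VP' = 0 := by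
    have h1 := congrArg transpose hcross
    simpa [Matrix.mul_assoc, KQ_symm] using h1
  let U : Matrix (Fin N) (Fin nP ⊕ Fin nM) ℚ := fromCols VP' VM'
  have hU : Function.Bijective U.mulVec := by
    constructor
    · have h : ∀ x, U *ᵥ x = 0 → x = 0 := by
        intro x hx
        rw [fromCols_mulVec] at hx
        have h1 := congrArg (WQ T *ᵥ ·) hx
        simp only [mulVec_add, mulVec_mulVec, hWP', hWM', neg_mulVec, mulVec_zero] at h1
        have h2 : VP' *ᵥ (x ∘ Sum.inl) = 0 := by
          ext i
          have e1 := congrFun hx i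
          have e2 := congrFun h1 i
          simp only [Pi.add_apply, Pi.neg_apply, Pi.zero_apply] at e1 e2 ⊢
          linarith
        have h3 : VM' *ᵥ (x ∘ Sum.inr) = 0 := by rwa [h2, zero_add] at hx
        have h4 := mulVec_injective_rat hVP (h2.trans (mulVec_zero _).symm)
        have h5 := mulVec_injective_rat hVM (h3.trans (mulVec_zero _).symm)
        ext (i | i)
        · exact congrFun h4 i
        · exact congrFun h5 i
      intro x y hxy
      exact sub_eq_zero.1 (h _ (by rw [mulVec_sub]; exact sub_eq_zero.2 hxy))
    · intro x
      have hW2 : WQ T *ᵥ (WQ T *ᵥ x) = x := by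
        rw [mulVec_mulVec, ← map_intCast_mul, T.W_sq,
          Matrix.map_one _ Int.cast_zero Int.cast_one, one_mulVec]
      obtain ⟨a, ha⟩ := exists_mulVec_eq_of_range hrP (x := x + WQ T *ᵥ x)
        (by rw [mulVec_add, hW2, one_smul, add_comm])
      obtain ⟨b, hb⟩ := exists_mulVec_eq_of_range hrM (x := x - WQ T *ᵥ x)
        (by rw [mulVec_sub, hW2, neg_one_smul, neg_sub])
      refine ⟨(1 / 2 : ℚ) • Sum.elim a b, ?_⟩
      rw [mulVec_smul, fromCols_mulVec, Sum.elim_comp_inl, Sum.elim_comp_inr, ← ha, ← hb]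
      ext i
      simp
      ring
  obtain ⟨Q, hUQ, hQU⟩ := exists_inverse_of_bijective hU
  set A := (T.restrict VP).map (Int.cast : ℤ → ℚ) with hA
  set B := (T.restrict VM).map (Int.cast : ℤ → ℚ) with hB
  have hAs : A.IsSymm := (restrict_isSymm T VP).map _
  have hBs : B.IsSymm := (restrict_isSymm T VM).map _
  have hK : Uᵀ * KQ T * U = fromBlocks A 0 0 B := by
    rw [transpose_fromCols, fromRows_mul, fromRows_mul_fromCols, hcross, hcross', hA, hB,
      restrict_map, restrict_map]
  have hK1 : Uᵀ * (T.K * (1 - T.W)).map (Int.cast : ℤ → ℚ) * U =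
      fromBlocks 0 0 0 ((2 : ℚ) • B) := by
    have h1 : (T.K * (1 - T.W)).map (Int.cast : ℤ → ℚ) = KQ T - KQ T * WQ T := by
      rw [Matrix.mul_sub, Matrix.mul_one, ← map_intCast_mul]
      ext
      simp
    have h2 : (KQ T - KQ T * WQ T) * U = fromCols 0 ((2 : ℚ) • (KQ T * VM')) := by
      rw [Matrix.sub_mul, Matrix.mul_assoc, mul_fromCols, mul_fromCols, mul_fromCols, hWP', hWM']
      ext i (j | j)
      · simp
      · simp
        ring
    rw [h1, Matrix.mul_assoc, h2, transpose_fromCols, fromRows_mul_fromCols, Matrix.mul_smul,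
      Matrix.mul_smul, ← Matrix.mul_assoc, ← Matrix.mul_assoc, hcross, hB, restrict_map]
    simp only [Matrix.mul_zero, smul_zero]
    rfl
  have hKs : (T.K * (1 - T.W)).IsSymm := by
    rw [Matrix.IsSymm, transpose_mul, transpose_sub, transpose_one, T.K_symm, Matrix.sub_mul,
      transpose_W_mul_K, Matrix.mul_sub, Matrix.one_mul, Matrix.mul_one]
  have hneg : ∀ (C : Matrix (Fin nP) (Fin nP) ℚ) (D : Matrix (Fin nM) (Fin nM) ℚ),
      -fromBlocks C 0 0 D = fromBlocks (-C) 0 0 (-D) := fun C D => by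
    rw [fromBlocks_neg, neg_zero, neg_zero]
  rw [sig_eq T.K_symm, ← sigPos_congruence (KQ T) hUQ hQU, ← sigPos_congruence (-KQ T) hUQ hQU,
    Matrix.mul_neg, Matrix.neg_mul, hK, hneg, sigPos_fromBlocks hAs hBs,
    sigPos_fromBlocks hAs.neg hBs.neg] at h_i
  have h0 : (0 : Matrix (Fin nP) (Fin nP) ℚ).IsSymm := isSymm_zero
  have hB2 : ((2 : ℚ) • B).IsSymm := hBs.smul 2
  rw [sig_eq hKs, ← sigPos_congruence (Matrix.map _ _) hUQ hQU,
    ← sigPos_congruence (-Matrix.map _ _) hUQ hQU,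
    Matrix.mul_neg, Matrix.neg_mul, hK1, hneg, sigPos_fromBlocks h0 hB2,
    sigPos_fromBlocks h0.neg hB2.neg, ← smul_neg, sigPos_two_smul hBs, sigPos_two_smul hBs.neg,
    neg_zero] at hsig
  rw [sig_eq (restrict_isSymm T VP), sig_eq (restrict_isSymm T VM)]
  push_cast at h_i hsig
  constructor <;> linarith

end Signature

end WittQ

theorem mainTheorem9 {N nP nM : ℕ} (T : ChiralEdge.EdgeTheory N)
    (VP : Matrix (Fin N) (Fin nP) ℤ) (VM : Matrix (Fin N) (Fin nM) ℤ)
    (hVP : ChiralEdge.IsLatticeBasis VP T.XiPlus)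
    (hVM : ChiralEdge.IsLatticeBasis VM T.XiMinus)
    (hsig : ChiralEdge.sig (T.K * (1 - T.W)) = 0)
    (h_i : ChiralEdge.sig T.K = 0)
    (h_ii : ∃ L : Set (Fin N → ℤ), T.IsLagrangian L ∧ T.IsInvariant L)
    (h_iii : T.IsFermionic →
      ChiralEdge.DetSigIsSquare (T.restrict VP) ∧ ChiralEdge.DetSigIsSquare (T.restrict VM)) :
    ChiralEdge.HasCompleteNullVectors (T.restrict VP) ∧
      ChiralEdge.HasCompleteNullVectors (T.restrict VM) := by
  obtain ⟨L, hL, hI⟩ := h_ii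
  have hrP : Set.range VP.mulVec = {Λ | T.W *ᵥ Λ = (1 : ℤ) • Λ} := by
    simp only [one_smul]
    exact hVP.2
  have hrM : Set.range VM.mulVec = {Λ | T.W *ᵥ Λ = (-1 : ℤ) • Λ} := by
    simp only [neg_one_smul]
    exact hVM.2
  obtain ⟨hP, hM⟩ := WittQ.sig_restrict_eq_zero hVP.1 hrP hVM.1 hrM hsig h_i
  have hsq {n : ℕ} {A : Matrix (Fin n) (Fin n) ℤ} (hA : ChiralEdge.sig A = 0)
      (h : ChiralEdge.DetSigIsSquare A) : IsSquare A.det.natAbs := by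
    simpa [ChiralEdge.DetSigIsSquare, hA] using h
  have heq {n : ℕ} {V : Matrix (Fin N) (Fin n) ℤ} (h : ChiralEdge.sig (T.restrict V) = 0) :
      sigPos ((T.restrict V).map (Int.cast : ℤ → ℚ)).toQuadraticForm' =
        sigNeg ((T.restrict V).map (Int.cast : ℤ → ℚ)).toQuadraticForm' := by
    rw [WittQ.sig_eq (WittQ.restrict_isSymm T V)] at h
    rw [WittQ.sigNeg_eq_sigPos_neg]
    omega
  exact ⟨WittQ.hasCompleteNullVectors_restrict hL hI (one_mul 1) hVP.1 hrP (heq hP)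
      fun hF => hsq hP (h_iii hF).1,
    WittQ.hasCompleteNullVectors_restrict hL hI (by norm_num) hVM.1 hrM (heq hM)
      fun hF => hsq hM (h_iii hF).2⟩
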